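/- **Setting.** Let $\mathcal D\subset\mathbb R^d$ be open, and let $H^1(\mathcal D)$ be the Sobolev space of $L^2(\mathcal D)$ functions with weak gradient in $L^2$. Write $\langle\cdot,\cdot\rangle$ for the $L^2(\mathcal D)$ inner product; in particular, for a product $gh$, $\langle gh,\phi\rangle=\int_{\mathcal D}gh\phi$. Let $\mathcal C_0$ be the covariance of a Gaussian prior on $L^2(\mathcal D)$, with positive self-adjoint injective square root $\mathcal C_0^{1/2}$, and let $\mathcal E=\mathrm{Im}(\mathcal C_0^{1/2})$ be its Cameron–Martin space, with $\langle x,y\rangle_{\mathcal E}=\langle\mathcal C_0^{-1/2}x,\mathcal C_0^{-1/2}y\rangle$. Assume $\mathcal E\subset L^\infty(\mathcal D)$. Let $m_0\in\mathcal E$ (prior mean), $\kappa\in\mathbb R$, $f_1,\dots,f_{N_s}$ bounded linear functionals on $H^1(\mathcal D)$ (sources), $B:H^1(\mathcal D)\to\mathbb R^q$ bounded linear (observation), $\mathbf d_1,\dots,\mathbf d_{N_s}\in\mathbb R^q$ (data), $\boldsymbol\Gamma$ a symmetric positive definite $q\times q$ matrix (noise covariance), $\langle a,b\rangle_{\boldsymbol\Gamma^{-1}}=a^T\boldsymbol\Gamma^{-1}b$,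 $z_1,\dots,z_{n_{tr}}\in L^2(\mathcal D)$ (trace-estimator directions), $\lambda\in\mathbb R$, and $N_w,n_{tr}\ge1$. For weights $\mathbf w=(\mathbf w^1,\dots,\mathbf w^{N_w})$, $\mathbf w^i\in\mathbb R^{N_s}$, put $f(\mathbf w^i)=\sum_jw^i_jf_j$, $\mathbf d(\mathbf w^i)=\sum_jw^i_j\mathbf d_j$. For $m\in\mathcal E$ and $u,v\in H^1(\mathcal D)$ let $a_m(u,v)=\langle\nabla u,\nabla v\rangle-\kappa^2\langle mu,v\rangle$ (weak Helmholtz operator with homogeneous Neumann conditions). **Constraints.** In all systems below $i=1,\dots,N_w$, $k=1,\dots,n_{tr}$, and the equations hold for all $\tilde u,\tilde p\in H^1(\mathcal D)$, $\tilde m\in\mathcal E$. *First-order optimality system* for $(m,\{u_i\},\{p_i\})\in\mathcal E\times H^1(\mathcal D)^{N_w}\times H^1(\mathcal D)^{N_w}$ (which defines the MAP point $m=m_{\rm MAP}(\mathbf w)$): $$a_m(u_i,\tilde p)-\langle f(\mathbf w^i),\tilde p\rangle=0,\qquad a_m(\tilde u,p_i)+\langle B\tilde u,Bu_i-\mathbf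 d(\mathbf w^i)\rangle_{\boldsymbol\Gamma^{-1}}=0,\qquad \langle m-m_0,\tilde m\rangle_{\mathcal E}-\tfrac1{N_w}\sum_i\kappa^2\langle u_ip_i,\tilde m\rangle=0.$$ *Hessian system at $(m,\{u_i\},\{p_i\})$ with right-hand side $F:\mathcal E\to\mathbb R$*, for $(y,\{v_i\},\{q_i\})$: $$a_m(v_i,\tilde p)-\kappa^2\langle u_iy,\tilde p\rangle=0,\qquad a_m(\tilde u,q_i)-\kappa^2\langle\tilde u,p_iy\rangle+\langle B\tilde u,Bv_i\rangle_{\boldsymbol\Gamma^{-1}}=0,\qquad \langle y,\tilde m\rangle_{\mathcal E}-\tfrac1{N_w}\sum_i\kappa^2\big[\langle v_ip_i,\tilde m\rangle+\langle u_iq_i,\tilde m\rangle\big]=F(\tilde m).$$ Variables $X=(m,\{u_i\},\{p_i\},\{v_{ik}\},\{q_{ik}\},\{y_k\})$ are *feasible* for $\mathbf w$ if $(m,\{u_i\},\{p_i\})$ solves the first-order system and, for each $k$, $(y_k,\{v_{ik}\}_i,\{q_{ik}\}_i)$ solves the Hessian system with $F(\tilde m)=\langle z_k,\tilde m\rangle$,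 i.e. $y_k=\mathcal H^{-1}z_k$. The objective is $$\Phi_L=\frac1{n_{tr}}\sum_k\langle y_k,z_k\rangle+\frac{\lambda}{2N_w}\sum_{i}\big(\|\mathbf w^i\|^2-1\big)^2 .$$ The Lagrangian $\mathscr L(\mathbf w,X,X^*)$, with multipliers $X^*=(m^*,\{u_i^*\},\{p_i^*\},\{v_{ik}^*\},\{q_{ik}^*\},\{y_k^*\})$ in the same spaces, is $$\begin{aligned}\mathscr L={}&\tfrac1{n_{tr}}\sum_k\langle y_k,z_k\rangle+\tfrac1{n_{tr}N_w}\sum_{k,i}\big[a_m(v_{ik},v_{ik}^*)-\kappa^2\langle u_iy_k,v_{ik}^*\rangle\big]\\&+\tfrac1{n_{tr}N_w}\sum_{k,i}\big[a_m(q_{ik}^*,q_{ik})-\kappa^2\langle q_{ik}^*,p_iy_k\rangle+\langle Bq_{ik}^*,Bv_{ik}\rangle_{\boldsymbol\Gamma^{-1}}\big]\\&+\tfrac1{n_{tr}}\sum_k\Big[\langle y_k,y_k^*\rangle_{\mathcal E}-\tfrac1{N_w}\sum_i\kappa^2\big(\langle v_{ik}p_i,y_k^*\rangle+\langle u_iq_{ik},y_k^*\rangle\big)-\langle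 z_k,y_k^*\rangle\Big]\\&+\tfrac1{N_w}\sum_i\big[a_m(u_i,u_i^*)-\langle f(\mathbf w^i),u_i^*\rangle\big]+\tfrac1{N_w}\sum_i\big[a_m(p_i^*,p_i)+\langle Bp_i^*,Bu_i-\mathbf d(\mathbf w^i)\rangle_{\boldsymbol\Gamma^{-1}}\big]\\&+\langle m-m_0,m^*\rangle_{\mathcal E}-\tfrac1{N_w}\sum_i\kappa^2\langle u_ip_i,m^*\rangle .\end{aligned}$$ **Hypotheses.** Let $X$ be feasible for $\mathbf w_0$, and suppose that at this $X$ (i) the Helmholtz problem is well posed: for every bounded linear functional $F$ on $H^1(\mathcal D)$ there is a unique $u\in H^1(\mathcal D)$ with $a_m(u,\cdot)=F$; and (ii) the Hessian is invertible: for every bounded linear functional $F$ on $\mathcal E$ the Hessian system at $(m,\{u_i\},\{p_i\})$ with right-hand side $F$ has a unique solution. A *branch* is a map $\mathbf w\mapsto X(\mathbf w)$ with $X(\mathbf w_0)=X$, with $\mathbf w\mapsto m(\mathbf w)\in\mathcal E$ continuous at $\mathbf w_0$, and with $X(\mathbf w)$ feasible for every $\mathbf w$ near $\mathbf w_0$.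 **Conclusions.** 1. A branch exists, and any two branches coincide near $\mathbf w_0$. 2. There is a unique $(m^*,\{u_i^*\},\{p_i^*\})\in\mathcal E\times H^1(\mathcal D)^{N_w}\times H^1(\mathcal D)^{N_w}$ solving the Hessian-type adjoint system $$\begin{aligned}a_m(p_i^*,\tilde p)-\kappa^2\langle u_im^*,\tilde p\rangle&=-\tfrac2{n_{tr}}\sum_k\kappa^2\langle v_{ik}y_k,\tilde p\rangle,\\ a_m(u_i^*,\tilde u)-\kappa^2\langle p_im^*,\tilde u\rangle+\langle Bp_i^*,B\tilde u\rangle_{\boldsymbol\Gamma^{-1}}&=-\tfrac2{n_{tr}}\sum_k\kappa^2\langle y_kq_{ik},\tilde u\rangle,\\ \langle m^*,\tilde m\rangle_{\mathcal E}-\tfrac1{N_w}\sum_i\kappa^2\big[\langle u_iu_i^*,\tilde m\rangle+\langle p_i^*p_i,\tilde m\rangle\big]&=-\tfrac2{n_{tr}N_w}\sum_{k,i}\kappa^2\langle v_{ik}q_{ik},\tilde m\rangle .\end{aligned}$$ 3. Multipliers $X^*$ make all directional derivatives of $\mathscr L(\mathbf w_0,\cdot,X^*)$ in the state variables $m,u,p,v,q,y$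 vanish at $X$ if and only if $y_k=-y_k^*$, $v_{ik}=-q_{ik}^*$, $q_{ik}=-v_{ik}^*$ for all $i,k$ and $(m^*,\{u_i^*\},\{p_i^*\})$ solves the adjoint system of 2. 4. Along any branch, $\mathbf w\mapsto\Phi_L$ is Fréchet differentiable at $\mathbf w_0$, and the component of its gradient for the weight $w^i_j$ is $$-\frac1{N_w}\Big(\langle f_j,u_i^*\rangle+\langle Bp_i^*,\mathbf d_j\rangle_{\boldsymbol\Gamma^{-1}}\Big)+\frac{2\lambda}{N_w}\big(\|\mathbf w_0^i\|^2-1\big)\,w^i_{0,j},$$ where $u_i^*,p_i^*$ are those of 2. -/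

import Mathlib

open MeasureTheory Filter Topology
open scoped ContDiff ENNReal Matrix

noncomputable section

namespace AOptHelmholtz

/-! ### Function spaces on a domain of Euclidean space -/

/-- Physical space `ℝᵈ`. -/
abbrev Space (d : ℕ) := EuclideanSpace ℝ (Fin d)

/-- Scalar `L²(D)`. -/
abbrev L2 {d : ℕ} (D : Set (Space d)) := Lp ℝ 2 (volume.restrict D)

/-- Vector-valued `L²(D; ℝᵈ)`. -/
abbrev L2Vec {d : ℕ} (D : Set (Space d)) := Lp (Space d) 2 (volume.restrict D)

/-- `g` is the weak gradient of `u` on `D`: integration by parts holds against every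
smooth test function with compact support inside `D`. -/
def IsWeakGradient {d : ℕ} (D : Set (Space d)) (u : L2 D) (g : L2Vec D) : Prop :=
  ∀ φ : Space d → ℝ, ContDiff ℝ ∞ φ → HasCompactSupport φ → tsupport φ ⊆ D → ∀ i : Fin d,
    ∫ x in D, u x * fderiv ℝ φ x (EuclideanSpace.single i 1) = - ∫ x in D, g x i * φ x

section WeakGradient

variable {d : ℕ} {D : Set (Space d)}

theorem memLp_test {φ : Space d → ℝ} (h : ContDiff ℝ ∞ φ) (hc : HasCompactSupport φ) :
    MemLp φ 2 (volume.restrict D) :=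
  (h.continuous.memLp_of_hasCompactSupport hc).restrict D

theorem memLp_test_deriv {φ : Space d → ℝ} (h : ContDiff ℝ ∞ φ) (hc : HasCompactSupport φ)
    (e : Space d) : MemLp (fun x => fderiv ℝ φ x e) 2 (volume.restrict D) := by
  have h1 : Continuous fun x => fderiv ℝ φ x e :=
    (h.continuous_fderiv (by simp)).clm_apply continuous_const
  have h2 : HasCompactSupport fun x => fderiv ℝ φ x e := hc.fderiv_apply ℝ e
  exact (h1.memLp_of_hasCompactSupport h2).restrict D

theorem integrable_mul_test {φ : Space d → ℝ} (u : L2 D) (hφ : MemLp φ 2 (volume.restrict D)) :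
    Integrable (fun x => u x * φ x) (volume.restrict D) :=
  (Lp.memLp u).integrable_mul hφ

theorem integrable_coord_mul_test {φ : Space d → ℝ} (g : L2Vec D) (i : Fin d)
    (hφ : MemLp φ 2 (volume.restrict D)) :
    Integrable (fun x => g x i * φ x) (volume.restrict D) := by
  have h : MemLp (fun x => g x i) 2 (volume.restrict D) :=
    (EuclideanSpace.proj i : Space d →L[ℝ] ℝ).comp_memLp' (Lp.memLp g)
  exact h.integrable_mul hφ

theorem isWeakGradient_zero : IsWeakGradient D 0 0 := by
  intro φ _ _ _ i
  have h1 : ∫ x in D, (0 : L2 D) x * fderiv ℝ φ x (EuclideanSpace.single i 1) = 0 := by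
    rw [← integral_zero (Space d) ℝ]
    refine integral_congr_ae ?_
    filter_upwards [Lp.coeFn_zero ℝ 2 (volume.restrict D)] with x hx
    simp only [hx, Pi.zero_apply, zero_mul]
  have h2 : ∫ x in D, (0 : L2Vec D) x i * φ x = 0 := by
    rw [← integral_zero (Space d) ℝ]
    refine integral_congr_ae ?_
    filter_upwards [Lp.coeFn_zero (Space d) 2 (volume.restrict D)] with x hx
    simp only [hx, Pi.zero_apply, PiLp.zero_apply, zero_mul]
  rw [h1, h2, neg_zero]

theorem IsWeakGradient.add {u₁ u₂ : L2 D} {g₁ g₂ : L2Vec D} (h₁ : IsWeakGradient D u₁ g₁)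
    (h₂ : IsWeakGradient D u₂ g₂) : IsWeakGradient D (u₁ + u₂) (g₁ + g₂) := by
  intro φ hφ hc hs i
  have e1 : ∫ x in D, (u₁ + u₂ : L2 D) x * fderiv ℝ φ x (EuclideanSpace.single i 1)
      = ∫ x in D, (u₁ x * fderiv ℝ φ x (EuclideanSpace.single i 1)
          + u₂ x * fderiv ℝ φ x (EuclideanSpace.single i 1)) := by
    refine integral_congr_ae ?_
    filter_upwards [Lp.coeFn_add u₁ u₂] with x hx
    simp only [hx, Pi.add_apply, add_mul]
  have e2 : ∫ x in D, (g₁ + g₂ : L2Vec D) x i * φ x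
      = ∫ x in D, (g₁ x i * φ x + g₂ x i * φ x) := by
    refine integral_congr_ae ?_
    filter_upwards [Lp.coeFn_add g₁ g₂] with x hx
    simp only [hx, Pi.add_apply, PiLp.add_apply, add_mul]
  rw [e1, e2, integral_add (integrable_mul_test _ (memLp_test_deriv hφ hc _))
    (integrable_mul_test _ (memLp_test_deriv hφ hc _)),
    integral_add (integrable_coord_mul_test _ _ (memLp_test hφ hc))
    (integrable_coord_mul_test _ _ (memLp_test hφ hc)), h₁ φ hφ hc hs i, h₂ φ hφ hc hs i]
  ring

theorem IsWeakGradient.smul {u : L2 D} {g : L2Vec D} (c : ℝ) (h : IsWeakGradient D u g) :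
    IsWeakGradient D (c • u) (c • g) := by
  intro φ hφ hc hs i
  have e1 : ∫ x in D, (c • u : L2 D) x * fderiv ℝ φ x (EuclideanSpace.single i 1)
      = ∫ x in D, c * (u x * fderiv ℝ φ x (EuclideanSpace.single i 1)) := by
    refine integral_congr_ae ?_
    filter_upwards [Lp.coeFn_smul c u] with x hx
    simp only [hx, Pi.smul_apply, smul_eq_mul, mul_assoc]
  have e2 : ∫ x in D, (c • g : L2Vec D) x i * φ x = ∫ x in D, c * (g x i * φ x) := by
    refine integral_congr_ae ?_
    filter_upwards [Lp.coeFn_smul c g] with x hx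
    simp only [hx, Pi.smul_apply, PiLp.smul_apply, smul_eq_mul, mul_assoc]
  rw [e1, e2, integral_const_mul, integral_const_mul, h φ hφ hc hs i]
  ring

end WeakGradient

/-- The Sobolev space `H¹(D)`, as the space of pairs `(u, ∇u)` in `L²(D) × L²(D; ℝᵈ)` with `∇u`
the weak gradient of `u`. The inherited inner product is `⟨u, v⟩ + ⟨∇u, ∇v⟩`. -/
def H1 {d : ℕ} (D : Set (Space d)) : Submodule ℝ (WithLp 2 (L2 D × L2Vec D)) where
  carrier := {x | IsWeakGradient D x.fst x.snd}
  add_mem' := fun ha hb => IsWeakGradient.add ha hb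
  zero_mem' := isWeakGradient_zero
  smul_mem' := fun c _ hx => IsWeakGradient.smul c hx

/-- The function underlying an element of `H¹(D)`. -/
def fn {d : ℕ} {D : Set (Space d)} (u : H1 D) : L2 D := u.1.fst

/-- The weak gradient of an element of `H¹(D)`. -/
def grad {d : ℕ} {D : Set (Space d)} (u : H1 D) : L2Vec D := u.1.snd

/-! ### Gaussian prior and its Cameron-Martin space -/

/-- The covariance `C₀` of a nondegenerate Gaussian prior on `L²(D)`, given through its positive
square root `C₀^{1/2}`. -/
structure PriorCov {d : ℕ} (D : Set (Space d)) where
  /-- The operator `C₀^{1/2}`. -/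
  sqrtCov : L2 D →L[ℝ] L2 D
  isPositive : sqrtCov.IsPositive
  injective : Function.Injective sqrtCov

namespace PriorCov

variable {d : ℕ} {D : Set (Space d)} (C : PriorCov D)

/-- The covariance operator `C₀ = C₀^{1/2} C₀^{1/2}`. -/
def cov : L2 D →L[ℝ] L2 D := C.sqrtCov ∘L C.sqrtCov

/-- The Cameron-Martin space `E = Im (C₀^{1/2})`. It carries its own inner product, defined below,
not the one of `L²(D)`. -/
def CM : Type := LinearMap.range (C.sqrtCov : L2 D →ₗ[ℝ] L2 D)

instance : AddCommGroup C.CM :=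
  inferInstanceAs (AddCommGroup (LinearMap.range (C.sqrtCov : L2 D →ₗ[ℝ] L2 D)))

instance : Module ℝ C.CM :=
  inferInstanceAs (Module ℝ (LinearMap.range (C.sqrtCov : L2 D →ₗ[ℝ] L2 D)))

/-- The inclusion of `E` in `L²(D)`. -/
def toL2 : C.CM →ₗ[ℝ] L2 D := (LinearMap.range (C.sqrtCov : L2 D →ₗ[ℝ] L2 D)).subtype

/-- The bijection `C₀^{-1/2} : E → L²(D)`. -/
def invSqrt : C.CM ≃ₗ[ℝ] L2 D :=
  (LinearEquiv.ofInjective (C.sqrtCov : L2 D →ₗ[ℝ] L2 D) C.injective).symm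

theorem sqrtCov_invSqrt (x : C.CM) : C.sqrtCov (C.invSqrt x) = C.toL2 x :=
  congrArg Subtype.val
    ((LinearEquiv.ofInjective (C.sqrtCov : L2 D →ₗ[ℝ] L2 D) C.injective).apply_symm_apply x)

instance : NormedAddCommGroup C.CM :=
  NormedAddCommGroup.induced C.CM (L2 D) C.invSqrt.toLinearMap C.invSqrt.injective

/-- The inner product `⟨x, y⟩_E = ⟨C₀^{-1/2} x, C₀^{-1/2} y⟩` of the Cameron-Martin space. -/
instance : InnerProductSpace ℝ C.CM where
  toNormedSpace := NormedSpace.induced ℝ C.CM (L2 D) C.invSqrt.toLinearMap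
  inner x y := inner ℝ (C.invSqrt x) (C.invSqrt y)
  norm_sq_eq_re_inner x := norm_sq_eq_re_inner (𝕜 := ℝ) (C.invSqrt x)
  conj_inner_symm x y := inner_conj_symm (𝕜 := ℝ) (C.invSqrt x) (C.invSqrt y)
  add_left x y z := by rw [map_add, inner_add_left]
  smul_left x y r := by rw [LinearEquiv.map_smul, inner_smul_left]

end PriorCov

/-! ### The Helmholtz inverse problem with encoded sources -/

/-- The given data of the inverse problem: `Ns` sources and `q` receivers. -/
structure Problem {d : ℕ} (D : Set (Space d)) (q Ns : ℕ) where
  /-- The frequency. -/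
  κ : ℝ
  /-- The prior covariance. -/
  prior : PriorCov D
  /-- The prior mean. -/
  mean : prior.CM
  /-- The sources `f_j`, in the dual of `H¹(D)`. -/
  f : Fin Ns → (H1 D →L[ℝ] ℝ)
  /-- The observation operator. -/
  B : H1 D →L[ℝ] EuclideanSpace ℝ (Fin q)
  /-- The data vectors `d_j`. -/
  data : Fin Ns → EuclideanSpace ℝ (Fin q)
  /-- The noise covariance matrix. -/
  Γ : Matrix (Fin q) (Fin q) ℝ
  posDef : Γ.PosDef

/-- Encoding weights `w = (w¹, …, w^{Nw})` with `wⁱ ∈ ℝ^{Ns}`, with the Euclidean structure of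
`ℝ^{Nw Ns}`. -/
abbrev Weights (Nw Ns : ℕ) := PiLp 2 fun _ : Fin Nw => EuclideanSpace ℝ (Fin Ns)

/-- The variables `(m, u_i, p_i, v_{i,k}, q_{i,k}, y_k)` of the constraints. The same type is used
for the Lagrange multipliers `(m*, u_i*, p_i*, v_{i,k}*, q_{i,k}*, y_k*)`. -/
structure Vars {d : ℕ} {D : Set (Space d)} {q Ns : ℕ} (P : Problem D q Ns) (Nw ntr : ℕ) where
  m : P.prior.CM
  u : Fin Nw → H1 D
  p : Fin Nw → H1 D
  v : Fin Nw → Fin ntr → H1 D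
  q : Fin Nw → Fin ntr → H1 D
  y : Fin ntr → P.prior.CM

namespace Problem

variable {d : ℕ} {D : Set (Space d)} {q Ns : ℕ} (P : Problem D q Ns) {Nw ntr : ℕ}

/-- The inner product weighted by the inverse of the noise covariance. -/
def noiseInner (a b : EuclideanSpace ℝ (Fin q)) : ℝ := a.ofLp ⬝ᵥ (P.Γ⁻¹ *ᵥ b.ofLp)

/-- The encoded source `f(wⁱ) = ∑ⱼ wⁱⱼ fⱼ`. -/
def encSource (w : Weights Nw Ns) (i : Fin Nw) : H1 D →L[ℝ] ℝ := ∑ j, w i j • P.f j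

/-- The encoded data `d(wⁱ) = ∑ⱼ wⁱⱼ dⱼ`. -/
def encData (w : Weights Nw Ns) (i : Fin Nw) : EuclideanSpace ℝ (Fin q) := ∑ j, w i j • P.data j

/-- The integral over `D` of the product of a parameter field and two states. -/
def tri (a : P.prior.CM) (u v : H1 D) : ℝ :=
  ∫ x in D, P.prior.toL2 a x * fn u x * fn v x

/-- The weak form `⟨∇u, ∇v⟩ - κ² ⟨m u, v⟩` of the Helmholtz operator with homogeneous Neumann
boundary conditions. -/
def helm (m : P.prior.CM) (u v : H1 D) : ℝ :=
  inner ℝ (grad u) (grad v) - P.κ ^ 2 * P.tri m u v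

/-- The first-order optimality system of the inverse problem with encoded sources. -/
def FirstOrder (w : Weights Nw Ns) (m : P.prior.CM) (u p : Fin Nw → H1 D) : Prop :=
  (∀ i, ∀ p' : H1 D, P.helm m (u i) p' - P.encSource w i p' = 0) ∧
  (∀ i, ∀ u' : H1 D,
    P.helm m u' (p i) + P.noiseInner (P.B u') (P.B (u i) - P.encData w i) = 0) ∧
  (∀ m' : P.prior.CM,
    inner ℝ (m - P.mean) m' - 1 / (Nw : ℝ) * ∑ i, P.κ ^ 2 * P.tri m' (u i) (p i) = 0)

/-- The Hessian system at `(m, u, p)`: `y` is the image under the inverse Hessian of the functional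
`F` on the Cameron-Martin space, `v` and `q` are the incremental states and adjoints. -/
def HessianSystem (m : P.prior.CM) (u p : Fin Nw → H1 D) (F : P.prior.CM → ℝ)
    (y : P.prior.CM) (v q : Fin Nw → H1 D) : Prop :=
  (∀ i, ∀ p' : H1 D, P.helm m (v i) p' - P.κ ^ 2 * P.tri y (u i) p' = 0) ∧
  (∀ i, ∀ u' : H1 D, P.helm m u' (q i) - P.κ ^ 2 * P.tri y u' (p i)
    + P.noiseInner (P.B u') (P.B (v i)) = 0) ∧
  (∀ m' : P.prior.CM, inner ℝ y m'
    - 1 / (Nw : ℝ) * ∑ i, P.κ ^ 2 * (P.tri m' (v i) (p i) + P.tri m' (u i) (q i)) = F m')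

/-- The constraints: `(m, u, p)` solves the first-order optimality system for the weights `w`, and
`(y_k, v_{·,k}, q_{·,k})` solves the Hessian system in the direction `z_k`, i.e. `y_k = H⁻¹ z_k`. -/
def Feasible (z : Fin ntr → L2 D) (w : Weights Nw Ns) (X : Vars P Nw ntr) : Prop :=
  P.FirstOrder w X.m X.u X.p ∧
  ∀ k, P.HessianSystem X.m X.u X.p (fun m' => inner ℝ (z k) (P.prior.toL2 m'))
    (X.y k) (fun i => X.v i k) (fun i => X.q i k)

/-- The objective: trace estimator of the inverse Hessian plus penalty on the weights. -/
def objective (z : Fin ntr → L2 D) (lam : ℝ) (w : Weights Nw Ns) (y : Fin ntr → P.prior.CM) : ℝ :=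
  1 / (ntr : ℝ) * ∑ k, inner ℝ (P.prior.toL2 (y k)) (z k)
    + lam / (2 * (Nw : ℝ)) * ∑ i, (‖w i‖ ^ 2 - 1) ^ 2

/-- The Hessian-type system for `(m*, u_i*, p_i*)` at the point `X`. -/
def AdjointSystem (X : Vars P Nw ntr) (ms : P.prior.CM) (us ps : Fin Nw → H1 D) : Prop :=
  (∀ i, ∀ p' : H1 D, P.helm X.m (ps i) p' - P.κ ^ 2 * P.tri ms (X.u i) p'
    = -(2 / (ntr : ℝ)) * ∑ k, P.κ ^ 2 * P.tri (X.y k) (X.v i k) p') ∧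
  (∀ i, ∀ u' : H1 D, P.helm X.m (us i) u' - P.κ ^ 2 * P.tri ms (X.p i) u'
    + P.noiseInner (P.B (ps i)) (P.B u')
    = -(2 / (ntr : ℝ)) * ∑ k, P.κ ^ 2 * P.tri (X.y k) (X.q i k) u') ∧
  (∀ m' : P.prior.CM, inner ℝ ms m'
    - 1 / (Nw : ℝ) * ∑ i, P.κ ^ 2 * (P.tri m' (X.u i) (us i) + P.tri m' (ps i) (X.p i))
    = -(2 / ((ntr : ℝ) * (Nw : ℝ))) * ∑ k, ∑ i, P.κ ^ 2 * P.tri m' (X.v i k) (X.q i k))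

/-- The Lagrangian of the trace-estimator term under the constraints; `X` are the state variables
and `Y` the multipliers (starred variables). -/
def lagrangian (z : Fin ntr → L2 D) (w : Weights Nw Ns) (X Y : Vars P Nw ntr) : ℝ :=
  1 / (ntr : ℝ) * ∑ k, inner ℝ (P.prior.toL2 (X.y k)) (z k)
  + 1 / ((ntr : ℝ) * (Nw : ℝ)) * ∑ k, ∑ i,
      (P.helm X.m (X.v i k) (Y.v i k) - P.κ ^ 2 * P.tri (X.y k) (X.u i) (Y.v i k))
  + 1 / ((ntr : ℝ) * (Nw : ℝ)) * ∑ k, ∑ i,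
      (P.helm X.m (Y.q i k) (X.q i k) - P.κ ^ 2 * P.tri (X.y k) (Y.q i k) (X.p i)
        + P.noiseInner (P.B (Y.q i k)) (P.B (X.v i k)))
  + 1 / (ntr : ℝ) * ∑ k, (inner ℝ (X.y k) (Y.y k)
      - 1 / (Nw : ℝ) * ∑ i, P.κ ^ 2 *
          (P.tri (Y.y k) (X.v i k) (X.p i) + P.tri (Y.y k) (X.u i) (X.q i k))
      - inner ℝ (z k) (P.prior.toL2 (Y.y k)))
  + 1 / (Nw : ℝ) * ∑ i, (P.helm X.m (X.u i) (Y.u i) - P.encSource w i (Y.u i))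
  + 1 / (Nw : ℝ) * ∑ i, (P.helm X.m (Y.p i) (X.p i)
      + P.noiseInner (P.B (Y.p i)) (P.B (X.u i) - P.encData w i))
  + (inner ℝ (X.m - P.mean) Y.m
      - 1 / (Nw : ℝ) * ∑ i, P.κ ^ 2 * P.tri Y.m (X.u i) (X.p i))

/-- Stationarity of the Lagrangian with respect to every state variable: all directional
derivatives in `m`, `u`, `p`, `v`, `q` and `y` vanish at `X`. -/
def Stationary (z : Fin ntr → L2 D) (w : Weights Nw Ns) (X Y : Vars P Nw ntr) : Prop :=
  (∀ m', HasDerivAt (fun t : ℝ => P.lagrangian z w { X with m := X.m + t • m' } Y) 0 0) ∧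
  (∀ u', HasDerivAt (fun t : ℝ => P.lagrangian z w { X with u := X.u + t • u' } Y) 0 0) ∧
  (∀ p', HasDerivAt (fun t : ℝ => P.lagrangian z w { X with p := X.p + t • p' } Y) 0 0) ∧
  (∀ v', HasDerivAt (fun t : ℝ => P.lagrangian z w { X with v := X.v + t • v' } Y) 0 0) ∧
  (∀ q', HasDerivAt (fun t : ℝ => P.lagrangian z w { X with q := X.q + t • q' } Y) 0 0) ∧
  (∀ y', HasDerivAt (fun t : ℝ => P.lagrangian z w { X with y := X.y + t • y' } Y) 0 0)

/-- A local branch of solutions of the constraints through `X₀` at `w₀`, along which the parameter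
`m = m_MAP(w)` is continuous at `w₀` in the norm of the Cameron-Martin space. -/
structure IsBranch (z : Fin ntr → L2 D) (w₀ : Weights Nw Ns) (X₀ : Vars P Nw ntr)
    (X : Weights Nw Ns → Vars P Nw ntr) : Prop where
  base : X w₀ = X₀
  continuousAt : ContinuousAt (fun w => (X w).m) w₀
  feasible : ∀ᶠ w in 𝓝 w₀, P.Feasible z w (X w)

/-- The gradient of the objective: the vector with `(i, j)` component
`-(1/Nw) (⟨f_j, u_i*⟩ + ⟨B p_i*, d_j⟩) + (2 lam/Nw) (|wⁱ|² - 1) wⁱ_j`. -/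
def gradVector (lam : ℝ) (w : Weights Nw Ns) (us ps : Fin Nw → H1 D) : Weights Nw Ns :=
  WithLp.toLp 2 fun i => WithLp.toLp 2 fun j =>
    -(1 / (Nw : ℝ)) * (P.f j (us i) + P.noiseInner (P.B (ps i)) (P.data j))
      + 2 * lam / (Nw : ℝ) * (‖w i‖ ^ 2 - 1) * w i j

end Problem

end AOptHelmholtz

end

open AOptHelmholtz

/-!
The parameter `m`, the states `u_i` and the adjoint states `p_i` form one unknown `s`, and the
first-order optimality system says that `s` is a critical point of the Lagrangian of the inverse
problem. Up to terms linear in `s` this Lagrangian is `‖m‖²/2 + (1/N) ∑ᵢ (⟨∇uᵢ, ∇pᵢ⟩ + |B uᵢ|²/2)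
- (1/N) ∑ᵢ κ² ∫ m uᵢ pᵢ`: a quadratic form `Λ` plus a cubic form `T`, both symmetric after
polarization. Sources and data enter through a load `c w` that is linear in the weights. Hence

* the first-order system reads `Λ s + T(s, s)/2 - g = c w` (`firstOrder_iff`);
* the Hessian systems read `(Λ + T s) h_k = ℓ_k`, with the symmetric operator `Λ + T s`
  (`feasible_iff`);
* the adjoint system reads `(Λ + T s) σ = (1/n) ∑ₖ T(h_k, h_k)`, where `σ = (m*, p*, u*)`: the roles
  of state and adjoint are exchanged (`adjointSystem_iff`);
* the Lagrangian of the trace estimator is `(1/n) ∑ₖ ℓ_k(h_k) + (1/n) ∑ₖ ((Λ + T s)(h_k, η_k)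
  - ℓ_k(η_k)) + (Λ s + T(s, s)/2 - g - c w)(σ)` (`lagrangian_eq`).

The analytic input is that `κ² ∫ m u v` is a bounded trilinear form, which follows from the closed
graph theorem for the inclusion of the Cameron-Martin space in `L^∞` (`exists_clm_tri`), and that
`Λ + T s₀` is invertible as an operator into the dual: right-hand sides acting on states and adjoint
states are removed by solving Helmholtz problems, the others are the Hessian systems of the
hypothesis (`isInvertible_hess`).

The four conclusions follow. The inverse function theorem applied to `s ↦ Λ s + T(s, s)/2 - g` gives
the branch; its uniqueness needs continuity of `m` only, because `u` and `p` solve Helmholtz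
problems whose coefficient is `m` (`tendsto_of_tendsto_param`). The adjoint system is uniquely
solvable by invertibility. Stationarity in `h_k` reads `(Λ + T s)(η_k + h_k) = 0`, so `η_k = -h_k`,
and stationarity in `s` is then the adjoint system (`stationary_lagr_iff`). Finally, symmetry gives
the derivative `-T(s', h_k, h_k)` for `ℓ_k(h_k)` along a branch with derivative `s'`, and summation
yields `-((Λ + T s) σ)(s') = -(c w')(σ)`, which is the stated gradient (`hasFDerivAt_trace`).
-/

noncomputable section

/-! ### Linear equations depending on a parameter -/

section LinearEquations

variable {α X Y : Type*} [NormedAddCommGroup X] [NormedSpace ℝ X] [NormedAddCommGroup Y]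
  [NormedSpace ℝ Y] [CompleteSpace X]

theorem ContinuousLinearMap.isInvertible_of_bijective [CompleteSpace Y] {A : X →L[ℝ] Y}
    (h : Function.Bijective A) : A.IsInvertible :=
  ⟨ContinuousLinearEquiv.ofBijective A (LinearMap.ker_eq_bot.2 h.1) (LinearMap.range_eq_top.2 h.2),
    ContinuousLinearEquiv.coe_ofBijective _ _ _⟩

theorem ContinuousLinearMap.IsInvertible.eventually {A : α → X →L[ℝ] Y} {A₀ : X →L[ℝ] Y}
    {l : Filter α} (h : A₀.IsInvertible) (hA : Tendsto A l (𝓝 A₀)) :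
    ∀ᶠ a in l, (A a).IsInvertible := by
  obtain ⟨e, rfl⟩ := h
  filter_upwards [hA e.nhds] with a ha
  exact ha

/-- Solutions of linear equations depend continuously on the operator and the right-hand side. -/
theorem tendsto_of_eventually_apply_eq {A : α → X →L[ℝ] Y} {A₀ : X →L[ℝ] Y} {b : α → Y} {b₀ : Y}
    {x : α → X} {x₀ : X} {l : Filter α} (h : A₀.IsInvertible) (hA : Tendsto A l (𝓝 A₀))
    (hb : Tendsto b l (𝓝 b₀)) (hx : ∀ᶠ a in l, A a (x a) = b a) (hx₀ : A₀ x₀ = b₀) :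
    Tendsto x l (𝓝 x₀) := by
  have hinv : Tendsto (fun a => (A a).inverse (b a)) l (𝓝 (A₀.inverse b₀)) := by
    obtain ⟨e, rfl⟩ := h
    have h1 := (contDiffAt_map_inverse (n := 0) (𝕜 := ℝ) e).continuousAt.tendsto.comp hA
    exact (isBoundedBilinearMap_apply.continuous.tendsto _).comp (h1.prodMk_nhds hb)
  have h0 : A₀.inverse b₀ = x₀ := by
    rw [← hx₀, h.inverse_apply_self]
  rw [h0] at hinv
  refine hinv.congr' ?_
  filter_upwards [hx, h.eventually hA] with a ha hia
  rw [← ha, hia.inverse_apply_self]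

end LinearEquations

/-! ### Critical points of a cubic functional -/

section CubicFunctional

variable {S W : Type*} [NormedAddCommGroup S] [NormedSpace ℝ S] [NormedAddCommGroup W]
  [NormedSpace ℝ W]

/-- The derivative at `s` of the cubic functional `s ↦ Λ(s, s)/2 + T(s, s, s)/6 - g(s)`, for
symmetric `Λ` and `T`. -/
def cubicGrad (Λ : S →L[ℝ] S →L[ℝ] ℝ) (T : S →L[ℝ] S →L[ℝ] S →L[ℝ] ℝ) (g : S →L[ℝ] ℝ)
    (s : S) : S →L[ℝ] ℝ :=
  Λ s + (1 / 2 : ℝ) • T s s - g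

/-- The second derivative at `s` of the cubic functional `s ↦ Λ(s, s)/2 + T(s, s, s)/6 - g(s)`, for
symmetric `Λ` and `T`. -/
def cubicHess (Λ : S →L[ℝ] S →L[ℝ] ℝ) (T : S →L[ℝ] S →L[ℝ] S →L[ℝ] ℝ) (s : S) :
    S →L[ℝ] S →L[ℝ] ℝ :=
  Λ + T s

variable {Λ : S →L[ℝ] S →L[ℝ] ℝ} {T : S →L[ℝ] S →L[ℝ] S →L[ℝ] ℝ} {g : S →L[ℝ] ℝ}

theorem hasStrictFDerivAt_cubicGrad (hT : ∀ a b, T a b = T b a) (s : S) :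
    HasStrictFDerivAt (cubicGrad Λ T g) (cubicHess Λ T s) s := by
  have h1 : HasStrictFDerivAt (fun s => T s s) (T s + T.flip s) s := by
    have := (T.hasStrictFDerivAt (x := s)).clm_apply (hasStrictFDerivAt_id s)
    exact this
  have h2 := ((Λ.hasStrictFDerivAt (x := s)).add (h1.const_smul (1 / 2 : ℝ))).sub_const g
  have hflip : T.flip s = T s := by
    ext a : 1
    rw [ContinuousLinearMap.flip_apply, hT]
  have hsum : (1 / 2 : ℝ) • (T s + T.flip s) = T s := by
    rw [hflip, ← two_smul ℝ (T s), smul_smul]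
    norm_num
  rw [hsum] at h2
  exact h2

-- needed for the topological group structure of spaces of bilinear forms
set_option maxSynthPendingDepth 2 in
theorem continuous_cubicHess : Continuous (cubicHess Λ T) :=
  continuous_const.add T.continuous

variable [CompleteSpace S]

/-- Inverse function theorem for critical points: at a nondegenerate critical point `s₀` of the
functional tilted by `c w₀`, the critical points for nearby `w` form one branch, whose
derivative is obtained by linearization. -/
theorem exists_branch_cubicGrad (hT : ∀ a b, T a b = T b a) {s₀ : S} {w₀ : W}
    (hinv : (cubicHess Λ T s₀).IsInvertible) (c : W →L[ℝ] S →L[ℝ] ℝ)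
    (h₀ : cubicGrad Λ T g s₀ = c w₀) :
    ∃ (σ : W → S) (σ' : W →L[ℝ] S), σ w₀ = s₀ ∧ HasFDerivAt σ σ' w₀ ∧
      (∀ w, cubicHess Λ T s₀ (σ' w) = c w) ∧
      (∀ᶠ w in 𝓝 w₀, cubicGrad Λ T g (σ w) = c w) ∧
      ∀ τ : W → S, Tendsto τ (𝓝 w₀) (𝓝 s₀) → (∀ᶠ w in 𝓝 w₀, cubicGrad Λ T g (τ w) = c w) →
        τ =ᶠ[𝓝 w₀] σ := by
  obtain ⟨e, he⟩ := hinv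
  have hd : HasStrictFDerivAt (cubicGrad Λ T g) (e : S →L[ℝ] S →L[ℝ] ℝ) s₀ := by
    rw [he]; exact hasStrictFDerivAt_cubicGrad hT s₀
  have hc : Tendsto c (𝓝 w₀) (𝓝 (cubicGrad Λ T g s₀)) := by
    rw [h₀]; exact c.continuous.tendsto w₀
  refine ⟨fun w => hd.localInverse _ _ _ (c w), (e.symm : (S →L[ℝ] ℝ) →L[ℝ] S) ∘L c, ?_, ?_, ?_,
    ?_, ?_⟩
  · beta_reduce
    rw [← h₀]; exact hd.localInverse_apply_image
  · have h1 := hd.to_localInverse.hasFDerivAt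
    rw [h₀] at h1
    exact h1.comp w₀ c.hasFDerivAt
  · intro w
    rw [← he]
    simp
  · exact hc.eventually hd.eventually_right_inverse
  · intro τ hτ hτc
    filter_upwards [hτ.eventually hd.eventually_left_inverse, hτc] with w h1 h2
    rw [← h2, h1]

/-- Derivative of the quadratic form of the inverse Hessian along a branch. Symmetry of the Hessian
makes the derivative of `h` disappear. -/
theorem hasFDerivAt_apply_cubicHess_solution (hΛ : ∀ a b, Λ a b = Λ b a)
    (hT : ∀ a b c, T a b c = T a c b)
    {σ h : W → S} {σ' : W →L[ℝ] S} {w₀ : W} (hσ : HasFDerivAt σ σ' w₀)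
    (hinv : (cubicHess Λ T (σ w₀)).IsInvertible) {ℓ : S →L[ℝ] ℝ}
    (hh : ∀ᶠ w in 𝓝 w₀, cubicHess Λ T (σ w) (h w) = ℓ) :
    HasFDerivAt (fun w => ℓ (h w)) (-((T.flip (h w₀)).flip (h w₀) ∘L σ')) w₀ := by
  have h0 : cubicHess Λ T (σ w₀) (h w₀) = ℓ := hh.self_of_nhds
  have hcont : ContinuousAt h w₀ :=
    tendsto_of_eventually_apply_eq hinv
      (continuous_cubicHess.continuousAt.comp hσ.continuousAt).tendsto tendsto_const_nhds hh h0
  -- `ℓ(h) - ℓ(h₀) = -T(σ - σ₀, h₀, h)`, by pairing the equation for `h` with `h₀` and conversely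
  have key : ∀ᶠ w in 𝓝 w₀,
      ℓ (h w) = ℓ (h w₀) - (T.flip (h w₀)) (σ w - σ w₀) (h w) := by
    filter_upwards [hh] with w hw
    have e1 : ℓ (h w) = Λ (h w₀) (h w) + T (σ w₀) (h w₀) (h w) := by
      rw [← h0]; rfl
    have e2 : ℓ (h w₀) = Λ (h w) (h w₀) + T (σ w) (h w) (h w₀) := by
      rw [← hw]; rfl
    rw [e1, e2, hΛ (h w), hT _ (h w)]
    simp only [map_sub, sub_apply, ContinuousLinearMap.flip_apply]
    ring
  have hT' : HasFDerivAt (fun w => (T.flip (h w₀)) (σ w - σ w₀))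
      (T.flip (h w₀) ∘L σ') w₀ :=
    (T.flip (h w₀)).hasFDerivAt.comp w₀ (hσ.sub_const (σ w₀))
  -- the factor `h` needs only to be continuous, since the other factor vanishes at `w₀`
  have hprod : HasFDerivAt (fun w => (T.flip (h w₀)) (σ w - σ w₀) (h w))
      ((T.flip (h w₀)).flip (h w₀) ∘L σ') w₀ := by
    have h1 : HasFDerivAt (fun w => (T.flip (h w₀)) (σ w - σ w₀) (h w₀))
        ((T.flip (h w₀)).flip (h w₀) ∘L σ') w₀ :=
      ((T.flip (h w₀)).flip (h w₀)).hasFDerivAt.comp w₀ (hσ.sub_const (σ w₀))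
    have h2 : HasFDerivAt (fun w => (T.flip (h w₀)) (σ w - σ w₀) (h w - h w₀))
        (0 : W →L[ℝ] ℝ) w₀ := by
      refine HasFDerivAt.of_isLittleO ?_
      have b1 : (fun w => (T.flip (h w₀)) (σ w - σ w₀)) =O[𝓝 w₀] fun w => w - w₀ := by
        simpa using hT'.isBigO_sub
      have b2 : (fun w => h w - h w₀) =o[𝓝 w₀] fun _ => (1 : ℝ) := by
        rw [Asymptotics.isLittleO_one_iff]
        simpa using hcont.tendsto.sub_const (h w₀)
      have b3 := b1.norm_norm.mul_isLittleO b2.norm_left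
      simp only [mul_one] at b3
      have b4 : (fun w => (T.flip (h w₀)) (σ w - σ w₀) (h w - h w₀)) =O[𝓝 w₀]
          fun w => ‖(T.flip (h w₀)) (σ w - σ w₀)‖ * ‖h w - h w₀‖ :=
        Asymptotics.IsBigO.of_bound 1 (Eventually.of_forall fun w => by
          rw [one_mul, norm_mul, norm_norm, norm_norm]
          exact ContinuousLinearMap.le_opNorm _ _)
      simpa using (b4.trans_isLittleO b3).norm_right.of_norm_right
    have h3 := h1.add h2
    rw [add_zero] at h3
    refine h3.congr_of_eventuallyEq (Eventually.of_forall fun w => ?_)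
    simp only [Pi.add_apply, map_sub]
    ring
  have h4 := hprod.const_sub (ℓ (h w₀))
  exact h4.congr_of_eventuallyEq key

end CubicFunctional

/-! ### Function spaces and trilinear forms -/

/-- Composition of a bounded trilinear form with bounded operators in its three arguments. -/
def ContinuousLinearMap.trilinearComp {E F G E' F' G' : Type*}
    [NormedAddCommGroup E] [NormedSpace ℝ E] [NormedAddCommGroup F] [NormedSpace ℝ F]
    [NormedAddCommGroup G] [NormedSpace ℝ G] [NormedAddCommGroup E'] [NormedSpace ℝ E']
    [NormedAddCommGroup F'] [NormedSpace ℝ F'] [NormedAddCommGroup G'] [NormedSpace ℝ G']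
    (t : E →L[ℝ] F →L[ℝ] G →L[ℝ] ℝ) (a : E' →L[ℝ] E) (b : F' →L[ℝ] F) (c : G' →L[ℝ] G) :
    E' →L[ℝ] F' →L[ℝ] G' →L[ℝ] ℝ :=
  ContinuousLinearMap.postcomp F' (ContinuousLinearMap.precomp ℝ c) ∘L
    ContinuousLinearMap.precomp (G →L[ℝ] ℝ) b ∘L t ∘L a

namespace AOptHelmholtz

variable {d : ℕ} {D : Set (Space d)}

theorem isClosed_H1 : IsClosed (H1 D : Set (WithLp 2 (L2 D × L2Vec D))) := by
  have h : (H1 D : Set (WithLp 2 (L2 D × L2Vec D))) = ⋂ (φ : Space d → ℝ), ⋂ (_ : ContDiff ℝ ∞ φ),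
      ⋂ (_ : HasCompactSupport φ), ⋂ (_ : tsupport φ ⊆ D), ⋂ (i : Fin d),
      {x | ∫ y in D, x.fst y * fderiv ℝ φ y (EuclideanSpace.single i 1)
        = - ∫ y in D, x.snd y i * φ y} := by
    ext x
    simp only [Set.mem_iInter, Set.mem_ofPred_eq]
    rfl
  rw [h]
  refine isClosed_iInter fun φ => isClosed_iInter fun hφ => isClosed_iInter fun hc =>
    isClosed_iInter fun _ => isClosed_iInter fun i => ?_
  have e1 : ∀ x : WithLp 2 (L2 D × L2Vec D),
      ∫ y in D, x.fst y * fderiv ℝ φ y (EuclideanSpace.single i 1)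
        = inner ℝ ((memLp_test_deriv (D := D) hφ hc (EuclideanSpace.single i 1)).toLp _)
            x.fst := by
    intro x
    rw [L2.inner_def]
    refine integral_congr_ae ?_
    filter_upwards [(memLp_test_deriv (D := D) hφ hc (EuclideanSpace.single i 1)).coeFn_toLp]
      with y hy
    rw [hy]
    rfl
  have e2 : ∀ x : WithLp 2 (L2 D × L2Vec D), ∫ y in D, x.snd y i * φ y
      = inner ℝ ((memLp_test (D := D) hφ hc).toLp _)
          ((EuclideanSpace.proj i : Space d →L[ℝ] ℝ).compLpL 2 (volume.restrict D) x.snd) := by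
    intro x
    rw [L2.inner_def]
    refine integral_congr_ae ?_
    filter_upwards [(memLp_test (D := D) hφ hc).coeFn_toLp,
      (EuclideanSpace.proj i : Space d →L[ℝ] ℝ).coeFn_compLpL x.snd] with y hy hy'
    rw [hy, hy']
    rfl
  simp only [e1, e2]
  have c1 : Continuous fun x : WithLp 2 (L2 D × L2Vec D) => x.fst :=
    (WithLp.fstL 2 ℝ (L2 D) (L2Vec D)).continuous
  have c2 : Continuous fun x : WithLp 2 (L2 D × L2Vec D) => x.snd :=
    (WithLp.sndL 2 ℝ (L2 D) (L2Vec D)).continuous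
  exact isClosed_eq (continuous_const.inner c1)
    (continuous_const.inner ((ContinuousLinearMap.continuous _).comp c2)).neg

/-- `H¹(D)` as a type of its own, on which the Hilbert space structure is given by named instances.
This keeps the types of multilinear forms on `H¹(D)` small. -/
def State (D : Set (Space d)) : Type := H1 D

instance : NormedAddCommGroup (State D) := inferInstanceAs (NormedAddCommGroup (H1 D))

instance : InnerProductSpace ℝ (State D) := inferInstanceAs (InnerProductSpace ℝ (H1 D))

instance : CompleteSpace (State D) := isClosed_H1.completeSpace_coe

/-- `fn` as a bounded operator `H¹(D) → L²(D)`. -/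
def fnL : State D →L[ℝ] L2 D :=
  show H1 D →L[ℝ] L2 D from WithLp.fstL 2 ℝ (L2 D) (L2Vec D) ∘L (H1 D).subtypeL

/-- `grad` as a bounded operator `H¹(D) → L²(D; ℝᵈ)`. -/
def gradL : State D →L[ℝ] L2Vec D :=
  show H1 D →L[ℝ] L2Vec D from WithLp.sndL 2 ℝ (L2 D) (L2Vec D) ∘L (H1 D).subtypeL

namespace PriorCov

variable (C : PriorCov D)

/-- `C₀^{-1/2}` as an isometry of the Cameron-Martin space onto `L²(D)`. -/
def invSqrtIsometry : C.CM ≃ₗᵢ[ℝ] L2 D := ⟨C.invSqrt, fun _ => rfl⟩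

instance : CompleteSpace C.CM :=
  (completeSpace_congr (e := C.invSqrtIsometry.toEquiv)
    C.invSqrtIsometry.isometry.isUniformEmbedding).2 inferInstance

/-- The inclusion of the Cameron-Martin space in `L²(D)` as a bounded operator. -/
def toL2L : C.CM →L[ℝ] L2 D := C.sqrtCov ∘L C.invSqrtIsometry.toContinuousLinearEquiv

theorem toL2L_apply (x : C.CM) : C.toL2L x = C.toL2 x := C.sqrtCov_invSqrt x

/-- By the closed graph theorem, a Cameron-Martin space contained in `L^∞(D)` is embedded
continuously. -/
theorem exists_clm_Linfty (hbdd : ∀ m : C.CM, MemLp (C.toL2 m) ∞ (volume.restrict D)) :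
    ∃ ι : C.CM →L[ℝ] Lp ℝ ∞ (volume.restrict D), ∀ m, ι m =ᵐ[volume.restrict D] C.toL2 m := by
  let ι₀ : C.CM →ₗ[ℝ] Lp ℝ ∞ (volume.restrict D) :=
    { toFun := fun m => (hbdd m).toLp _
      map_add' := by
        intro x y
        rw [← MemLp.toLp_add]
        refine MemLp.toLp_congr _ _ ?_
        rw [map_add]
        exact Lp.coeFn_add _ _
      map_smul' := by
        intro c x
        rw [RingHom.id_apply, ← MemLp.toLp_const_smul]
        refine MemLp.toLp_congr _ _ ?_
        rw [map_smul]
        exact Lp.coeFn_smul _ _ }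
  have hι : ∀ m, ι₀ m =ᵐ[volume.restrict D] C.toL2 m := fun m => (hbdd m).coeFn_toLp
  refine ⟨ContinuousLinearMap.ofSeqClosedGraph (g := ι₀) ?_, hι⟩
  intro u x y hu hy
  -- limits in `L²` and in `L^∞` agree because both are limits in measure
  have h1 : Tendsto (fun n => C.toL2L (u n)) atTop (𝓝 (C.toL2L x)) :=
    (C.toL2L.continuous.tendsto x).comp hu
  have m1 := tendstoInMeasure_of_tendsto_Lp h1
  have m2 := tendstoInMeasure_of_tendsto_Lp hy
  have m3 : TendstoInMeasure (volume.restrict D) 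
      (fun n => (C.toL2L (u n) : Space d → ℝ)) atTop y := by
    refine m2.congr' (Eventually.of_forall fun n => ?_) EventuallyEq.rfl
    rw [C.toL2L_apply]
    exact hι (u n)
  have h2 := tendstoInMeasure_ae_unique m3 m1
  refine Lp.ext (h2.trans ?_)
  rw [C.toL2L_apply]
  exact (hι x).symm

end PriorCov

/-! ### The forms of the problem as bounded multilinear maps -/

/-- The bounded trilinear form `(a, u, v) ↦ ∫ a u v` on `L^∞(D) × L²(D) × L²(D)`. -/
def integralTriL (D : Set (Space d)) :
    Lp ℝ ∞ (volume.restrict D) →L[ℝ] L2 D →L[ℝ] L2 D →L[ℝ] ℝ :=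
  ContinuousLinearMap.postcomp (L2 D) (innerSL ℝ (E := L2 D)) ∘L
    (ContinuousLinearMap.mul ℝ ℝ).holderL (volume.restrict D) ∞ 2 2

theorem integralTriL_apply (a : Lp ℝ ∞ (volume.restrict D)) (u v : L2 D) :
    integralTriL D a u v = ∫ x in D, a x * u x * v x := by
  change inner ℝ ((ContinuousLinearMap.mul ℝ ℝ).holder 2 a u) v = _
  rw [L2.inner_def]
  refine integral_congr_ae ?_
  filter_upwards [(ContinuousLinearMap.mul ℝ ℝ).coeFn_holder (r := 2) a u] with x hx
  rw [hx, ContinuousLinearMap.mul_apply']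
  exact mul_comm _ _

namespace Problem

variable {q Ns : ℕ} (P : Problem D q Ns)

/-- The trilinear form `κ² tri` is bounded when the Cameron-Martin space lies in `L^∞(D)`. -/
theorem exists_clm_tri (hbdd : ∀ m : P.prior.CM, MemLp (P.prior.toL2 m) ∞ (volume.restrict D)) :
    ∃ τ : P.prior.CM →L[ℝ] State D →L[ℝ] State D →L[ℝ] ℝ,
      ∀ a u v, τ a u v = P.κ ^ 2 * P.tri a u v := by
  refine (P.prior.exists_clm_Linfty hbdd).elim fun ι hι =>
    ⟨(integralTriL D).trilinearComp (P.κ ^ 2 • ι) fnL fnL, fun a u v => ?_⟩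
  change integralTriL D (P.κ ^ 2 • ι a) (fn u) (fn v) = _
  refine (integralTriL_apply _ _ _).trans (Eq.trans ?_ (integral_const_mul _ _))
  refine integral_congr_ae ?_
  filter_upwards [hι a, Lp.coeFn_smul (P.κ ^ 2) (ι a)] with x hx hx'
  rw [hx', Pi.smul_apply, hx, smul_eq_mul]
  ring

theorem tri_comm (a : P.prior.CM) (u v : H1 D) : P.tri a u v = P.tri a v u := by
  unfold tri
  congr 1
  ext x
  ring

/-- The noise-weighted inner product as a bounded bilinear form. -/
def noiseL : EuclideanSpace ℝ (Fin q) →L[ℝ] EuclideanSpace ℝ (Fin q) →L[ℝ] ℝ :=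
  LinearMap.toContinuousLinearMap
    ((LinearMap.toContinuousLinearMap : (EuclideanSpace ℝ (Fin q) →ₗ[ℝ] ℝ) ≃ₗ[ℝ] _).toLinearMap ∘ₗ
      LinearMap.mk₂ ℝ P.noiseInner
        (fun a b c => by simp [noiseInner, add_dotProduct])
        (fun r a b => by simp [noiseInner, smul_dotProduct])
        (fun a b c => by simp [noiseInner, Matrix.mulVec_add, dotProduct_add])
        (fun r a b => by simp [noiseInner, Matrix.mulVec_smul, dotProduct_smul]))

theorem noiseL_apply (a b : EuclideanSpace ℝ (Fin q)) : P.noiseL a b = P.noiseInner a b := rfl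

theorem noiseL_comm (a b : EuclideanSpace ℝ (Fin q)) : P.noiseL a b = P.noiseL b a := by
  have h : P.Γ⁻¹ᵀ = P.Γ⁻¹ := by
    have := P.posDef.isHermitian.inv
    simpa [Matrix.IsHermitian] using this
  rw [noiseL_apply, noiseL_apply]
  unfold noiseInner
  rw [Matrix.dotProduct_mulVec, ← Matrix.mulVec_transpose, h, dotProduct_comm]

end Problem

end AOptHelmholtz

/-! ### The cubic functional of a bilinear inverse problem -/

/-- The swap of the last two arguments of a bounded trilinear form. -/
def ContinuousLinearMap.swapLast {S : Type*} [NormedAddCommGroup S] [NormedSpace ℝ S]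
    (t : S →L[ℝ] S →L[ℝ] S →L[ℝ] ℝ) : S →L[ℝ] S →L[ℝ] S →L[ℝ] ℝ :=
  (ContinuousLinearMap.flipₗᵢ ℝ S S ℝ).toContinuousLinearEquiv.toContinuousLinearMap ∘L t

-- needed for the additive structure of spaces of trilinear forms
set_option maxSynthPendingDepth 2 in
/-- A multiple of the sum of bounded trilinear forms over the permutations of their arguments. -/
def ContinuousLinearMap.symmetrizeSum {S ι : Type*} [NormedAddCommGroup S] [NormedSpace ℝ S]
    [Fintype ι] (r : ℝ) (t : ι → S →L[ℝ] S →L[ℝ] S →L[ℝ] ℝ) : S →L[ℝ] S →L[ℝ] S →L[ℝ] ℝ :=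
  r • ∑ i, (t i + (t i).swapLast + (t i).flip + (t i).flip.swapLast + (t i).swapLast.flip
    + (t i).swapLast.flip.swapLast)

set_option maxSynthPendingDepth 2 in
theorem ContinuousLinearMap.symmetrizeSum_apply {S ι : Type*} [NormedAddCommGroup S]
    [NormedSpace ℝ S] [Fintype ι] (r : ℝ) (t : ι → S →L[ℝ] S →L[ℝ] S →L[ℝ] ℝ) (a b c : S) :
    symmetrizeSum r t a b c = r * ∑ i,
      (t i a b c + t i a c b + t i b a c + t i c a b + t i b c a + t i c b a) := by
  simp only [symmetrizeSum, smul_apply, sum_apply, smul_eq_mul]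
  rfl

/-- The forms of an inverse problem with parameter space `E` and state space `H`: the inner product
of the prior, the principal part of the state equation, the observation misfit, and the product
coupling parameter and state (with the factor `κ²` included). -/
structure InverseForms (E H : Type*) [NormedAddCommGroup E] [NormedSpace ℝ E]
    [NormedAddCommGroup H] [NormedSpace ℝ H] where
  /-- The inner product of the prior. -/
  prior : E →L[ℝ] E →L[ℝ] ℝ
  /-- The principal part of the state equation. -/
  stiff : H →L[ℝ] H →L[ℝ] ℝ
  /-- The product of observations. -/
  obs : H →L[ℝ] H →L[ℝ] ℝ
  /-- The coupling of parameter and state; the state operator is `stiff - prod m`. -/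
  prod : E →L[ℝ] H →L[ℝ] H →L[ℝ] ℝ
  prior_comm : ∀ x y, prior x y = prior y x
  stiff_comm : ∀ x y, stiff x y = stiff y x
  obs_comm : ∀ x y, obs x y = obs y x
  prod_comm : ∀ a x y, prod a x y = prod a y x

namespace InverseForms

variable {E H W : Type*} [NormedAddCommGroup E] [NormedSpace ℝ E]
    [NormedAddCommGroup H] [NormedSpace ℝ H] [NormedAddCommGroup W] [NormedSpace ℝ W]
    (A : InverseForms E H) {N : ℕ}

/-- Parameter, states and adjoint states. -/
abbrev Point (E H : Type*) (N : ℕ) := E × (Fin N → H) × (Fin N → H)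

/-- The parameter component. -/
def prM : Point E H N →L[ℝ] E := ContinuousLinearMap.fst ℝ _ _

/-- The `i`-th state component. -/
def prU (i : Fin N) : Point E H N →L[ℝ] H :=
  ContinuousLinearMap.proj i ∘L ContinuousLinearMap.fst ℝ _ _ ∘L ContinuousLinearMap.snd ℝ _ _

/-- The `i`-th adjoint component. -/
def prP (i : Fin N) : Point E H N →L[ℝ] H :=
  ContinuousLinearMap.proj i ∘L ContinuousLinearMap.snd ℝ _ _ ∘L ContinuousLinearMap.snd ℝ _ _

/-- The quadratic part of the Lagrangian of the inverse problem,
`‖m‖²/2 + (1/N) ∑ᵢ (K(uᵢ, pᵢ) + R(uᵢ, uᵢ)/2)` with `K` the form `stiff` and `R` the form `obs`,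
polarized. -/
def quad (N : ℕ) : Point E H N →L[ℝ] Point E H N →L[ℝ] ℝ :=
  A.prior.bilinearComp prM prM + (1 / (N : ℝ)) • ∑ i, (A.stiff.bilinearComp (prU i) (prP i)
    + A.stiff.bilinearComp (prP i) (prU i) + A.obs.bilinearComp (prU i) (prU i))

/-- The cubic part of the Lagrangian of the inverse problem, `-(1/N) ∑ᵢ τ(m, uᵢ, pᵢ)` with `τ` the
product form, polarized. -/
def cubic (N : ℕ) : Point E H N →L[ℝ] Point E H N →L[ℝ] Point E H N →L[ℝ] ℝ :=
  ContinuousLinearMap.symmetrizeSum (-(1 / (N : ℝ))) fun i =>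
    A.prod.trilinearComp prM (prU i) (prP i)

theorem quad_apply (a b : Point E H N) : A.quad N a b = A.prior a.1 b.1 + 1 / (N : ℝ) * ∑ i,
    (A.stiff (a.2.1 i) (b.2.2 i) + A.stiff (a.2.2 i) (b.2.1 i) + A.obs (a.2.1 i) (b.2.1 i)) := by
  simp only [quad, add_apply, smul_apply,
    sum_apply, smul_eq_mul]
  rfl

theorem cubic_apply (a b c : Point E H N) : A.cubic N a b c = -(1 / (N : ℝ)) * ∑ i,
    (A.prod a.1 (b.2.1 i) (c.2.2 i) + A.prod a.1 (c.2.1 i) (b.2.2 i)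
      + A.prod b.1 (a.2.1 i) (c.2.2 i) + A.prod c.1 (a.2.1 i) (b.2.2 i)
      + A.prod b.1 (c.2.1 i) (a.2.2 i) + A.prod c.1 (b.2.1 i) (a.2.2 i)) :=
  ContinuousLinearMap.symmetrizeSum_apply _ _ a b c

theorem quad_comm (a b : Point E H N) : A.quad N a b = A.quad N b a := by
  rw [quad_apply, quad_apply, A.prior_comm]
  congr 2
  refine Finset.sum_congr rfl fun i _ => ?_
  rw [A.stiff_comm (a.2.1 i), A.stiff_comm (a.2.2 i), A.obs_comm (a.2.1 i)]
  ring

theorem cubic_comm_left (a b : Point E H N) : A.cubic N a b = A.cubic N b a := by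
  refine ContinuousLinearMap.ext fun c => ?_
  rw [cubic_apply, cubic_apply]
  congr 1
  refine Finset.sum_congr rfl fun i _ => ?_
  ring

theorem cubic_comm_right (a b c : Point E H N) : A.cubic N a b c = A.cubic N a c b := by
  rw [cubic_apply, cubic_apply]
  congr 1
  refine Finset.sum_congr rfl fun i _ => ?_
  ring

/-- The part of the derivative of the Lagrangian that depends on the experiment: sources `φ i w`
act on the adjoint components, data functionals `δ i w` on the state components. -/
def load (φ δ : Fin N → W →L[ℝ] H →L[ℝ] ℝ) : W →L[ℝ] Point E H N →L[ℝ] ℝ :=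
  (1 / (N : ℝ)) • ∑ i, (ContinuousLinearMap.precomp ℝ (prP i) ∘L φ i
    + ContinuousLinearMap.precomp ℝ (prU i) ∘L δ i)

theorem load_apply (φ δ : Fin N → W →L[ℝ] H →L[ℝ] ℝ) (w : W) (a : Point E H N) :
    load φ δ w a = 1 / (N : ℝ) * ∑ i, (φ i w (a.2.2 i) + δ i w (a.2.1 i)) := by
  simp only [load, smul_apply, sum_apply, smul_eq_mul]
  rfl

/-- First derivative of the Lagrangian of the inverse problem with prior mean `μ`, without the
terms of `load`. -/
def first (μ : E) (s : Point E H N) : Point E H N →L[ℝ] ℝ :=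
  cubicGrad (A.quad N) (A.cubic N) (A.prior μ ∘L prM) s

/-- Second derivative of the Lagrangian of the inverse problem. -/
def hess (s : Point E H N) : Point E H N →L[ℝ] Point E H N →L[ℝ] ℝ :=
  cubicHess (A.quad N) (A.cubic N) s

theorem hess_apply (s a b : Point E H N) : A.hess s a b = A.quad N a b + A.cubic N s a b := rfl

theorem first_apply (μ : E) (s b : Point E H N) :
    A.first μ s b = A.quad N s b + 1 / 2 * A.cubic N s s b - A.prior μ b.1 := rfl

theorem hess_comm (s a b : Point E H N) : A.hess s a b = A.hess s b a := by
  rw [hess_apply, hess_apply, A.quad_comm, A.cubic_comm_right]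

/-! ### Components of the optimality systems -/

theorem sum_single {x : Fin N → H →L[ℝ] ℝ} (j : Fin N) (h : H) :
    ∑ i, x i (Pi.single (M := fun _ => H) j h i) = x j h := by
  rw [Finset.sum_eq_single j, Pi.single_eq_same]
  · intro i _ hi
    rw [Pi.single_eq_of_ne hi, map_zero]
  · simp

/-- A functional on `Point E H N` is determined by its components. -/
theorem ext_components {Ψ Φ : Point E H N →L[ℝ] ℝ}
    (h₁ : ∀ m, Ψ (m, 0, 0) = Φ (m, 0, 0))
    (h₂ : ∀ i u, Ψ (0, Pi.single i u, 0) = Φ (0, Pi.single i u, 0))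
    (h₃ : ∀ i p, Ψ (0, 0, Pi.single i p) = Φ (0, 0, Pi.single i p)) : Ψ = Φ := by
  refine ContinuousLinearMap.ext fun s => ?_
  obtain ⟨m, u, p⟩ := s
  have e : (m, u, p) = ((m, 0, 0) : Point E H N) + ∑ i, ((0, Pi.single i (u i), 0) : Point E H N)
      + ∑ i, ((0, 0, Pi.single i (p i)) : Point E H N) := by
    refine Prod.ext ?_ (Prod.ext ?_ ?_)
    · simp [Prod.fst_sum]
    · simp [Prod.fst_sum, Prod.snd_sum, Finset.univ_sum_single]
    · simp [Prod.snd_sum, Finset.univ_sum_single]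
  rw [e]
  simp only [map_add, map_sum, h₁, h₂, h₃]

theorem quad_param (a : Point E H N) (m : E) : A.quad N a (m, 0, 0) = A.prior a.1 m := by
  simp [quad_apply]

theorem quad_state (a : Point E H N) (i : Fin N) (u : H) : A.quad N a (0, Pi.single i u, 0)
    = 1 / (N : ℝ) * (A.stiff (a.2.2 i) u + A.obs (a.2.1 i) u) := by
  rw [quad_apply]
  have h := sum_single (x := fun i => A.stiff (a.2.2 i) + A.obs (a.2.1 i)) i u
  simpa [add_apply] using congrArg (1 / (N : ℝ) * ·) h

theorem quad_adjoint (a : Point E H N) (i : Fin N) (p : H) : A.quad N a (0, 0, Pi.single i p)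
    = 1 / (N : ℝ) * A.stiff (a.2.1 i) p := by
  rw [quad_apply]
  have h := sum_single (x := fun i => A.stiff (a.2.1 i)) i p
  simpa using congrArg (1 / (N : ℝ) * ·) h

theorem cubic_param (a b : Point E H N) (m : E) : A.cubic N a b (m, 0, 0)
    = -(1 / (N : ℝ)) * ∑ i, (A.prod m (a.2.1 i) (b.2.2 i) + A.prod m (b.2.1 i) (a.2.2 i)) := by
  simp [cubic_apply]

theorem cubic_state (a b : Point E H N) (i : Fin N) (u : H) :
    A.cubic N a b (0, Pi.single i u, 0)
      = -(1 / (N : ℝ)) * (A.prod a.1 (b.2.2 i) u + A.prod b.1 (a.2.2 i) u) := by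
  rw [cubic_apply]
  have h := sum_single (x := fun i => A.prod a.1 (b.2.2 i) + A.prod b.1 (a.2.2 i)) i u
  simp only [A.prod_comm a.1 (Pi.single (M := fun _ => H) i u _),
    A.prod_comm b.1 (Pi.single (M := fun _ => H) i u _)]
  simpa [add_apply] using congrArg (-(1 / (N : ℝ)) * ·) h

theorem cubic_adjoint (a b : Point E H N) (i : Fin N) (p : H) :
    A.cubic N a b (0, 0, Pi.single i p)
      = -(1 / (N : ℝ)) * (A.prod a.1 (b.2.1 i) p + A.prod b.1 (a.2.1 i) p) := by
  rw [cubic_apply]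
  have h := sum_single (x := fun i => A.prod a.1 (b.2.1 i) + A.prod b.1 (a.2.1 i)) i p
  simpa [add_apply] using congrArg (-(1 / (N : ℝ)) * ·) h

theorem load_param (φ δ : Fin N → W →L[ℝ] H →L[ℝ] ℝ) (w : W) (m : E) :
    load φ δ w (m, 0, 0) = 0 := by
  simp [load_apply]

theorem load_state (φ δ : Fin N → W →L[ℝ] H →L[ℝ] ℝ) (w : W) (i : Fin N) (u : H) :
    load (E := E) φ δ w (0, Pi.single i u, 0) = 1 / (N : ℝ) * δ i w u := by
  have h := sum_single (x := fun i => δ i w) i u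
  simpa [load_apply] using congrArg (1 / (N : ℝ) * ·) h

theorem load_adjoint (φ δ : Fin N → W →L[ℝ] H →L[ℝ] ℝ) (w : W) (i : Fin N) (p : H) :
    load (E := E) φ δ w (0, 0, Pi.single i p) = 1 / (N : ℝ) * φ i w p := by
  have h := sum_single (x := fun i => φ i w) i p
  simpa [load_apply] using congrArg (1 / (N : ℝ) * ·) h

theorem eq_iff_components {Ψ Φ : Point E H N →L[ℝ] ℝ} : Ψ = Φ ↔
    (∀ i p, Ψ (0, 0, Pi.single i p) = Φ (0, 0, Pi.single i p)) ∧
    (∀ i u, Ψ (0, Pi.single i u, 0) = Φ (0, Pi.single i u, 0)) ∧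
    (∀ m, Ψ (m, 0, 0) = Φ (m, 0, 0)) :=
  ⟨fun h => by rw [h]; exact ⟨fun _ _ => rfl, fun _ _ => rfl, fun _ => rfl⟩,
    fun h => ext_components h.2.2 h.2.1 h.1⟩

/-- The first-order system, tested component by component. The states and adjoint states carry the
weight `1 / N`, which cancels. -/
theorem first_eq_load_iff (hN : 0 < N) (φ δ : Fin N → W →L[ℝ] H →L[ℝ] ℝ) (w : W) (μ : E)
    (s : Point E H N) : A.first μ s = load φ δ w ↔
      (∀ i p, A.stiff (s.2.1 i) p - A.prod s.1 (s.2.1 i) p = φ i w p) ∧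
      (∀ i u, A.stiff (s.2.2 i) u - A.prod s.1 (s.2.2 i) u + A.obs (s.2.1 i) u = δ i w u) ∧
      (∀ m, A.prior (s.1 - μ) m - 1 / (N : ℝ) * ∑ i, A.prod m (s.2.1 i) (s.2.2 i) = 0) := by
  have hN' : (1 / (N : ℝ)) ≠ 0 := by positivity
  rw [eq_iff_components]
  refine and_congr (forall₂_congr fun i p => ?_) (and_congr (forall₂_congr fun i u => ?_)
    (forall_congr' fun m => ?_))
  · rw [first_apply, quad_adjoint, cubic_adjoint, load_adjoint, map_zero]
    refine ⟨fun h => mul_left_cancel₀ hN' ?_, fun h => ?_⟩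
    · linear_combination h
    · linear_combination (1 / (N : ℝ)) * h
  · rw [first_apply, quad_state, cubic_state, load_state, map_zero]
    refine ⟨fun h => mul_left_cancel₀ hN' ?_, fun h => ?_⟩
    · linear_combination h
    · linear_combination (1 / (N : ℝ)) * h
  · rw [first_apply, quad_param, cubic_param, load_param, map_sub, sub_apply,
      Finset.sum_add_distrib]
    refine ⟨fun h => ?_, fun h => ?_⟩
    · linear_combination h
    · linear_combination h

/-- The Hessian system with a general right-hand side, tested component by component. -/
theorem hess_eq_iff (hN : 0 < N) (s a : Point E H N) (Ψ : Point E H N →L[ℝ] ℝ) :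
    A.hess s a = Ψ ↔
      (∀ i p, A.stiff (a.2.1 i) p - A.prod s.1 (a.2.1 i) p - A.prod a.1 (s.2.1 i) p
        = N * Ψ (0, 0, Pi.single i p)) ∧
      (∀ i u, A.stiff (a.2.2 i) u - A.prod s.1 (a.2.2 i) u - A.prod a.1 (s.2.2 i) u
        + A.obs (a.2.1 i) u = N * Ψ (0, Pi.single i u, 0)) ∧
      (∀ m, A.prior a.1 m - 1 / (N : ℝ) * ∑ i,
        (A.prod m (s.2.1 i) (a.2.2 i) + A.prod m (a.2.1 i) (s.2.2 i)) = Ψ (m, 0, 0)) := by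
  have hN' : (N : ℝ) ≠ 0 := by positivity
  rw [eq_iff_components]
  refine and_congr (forall₂_congr fun i p => ?_) (and_congr (forall₂_congr fun i u => ?_)
    (forall_congr' fun m => ?_))
  · rw [hess_apply, quad_adjoint, cubic_adjoint]
    refine ⟨fun h => ?_, fun h => mul_left_cancel₀ hN' ?_⟩
    · rw [← h]; field_simp; ring
    · rw [← h]; field_simp; ring
  · rw [hess_apply, quad_state, cubic_state]
    refine ⟨fun h => ?_, fun h => mul_left_cancel₀ hN' ?_⟩
    · rw [← h]; field_simp; ring
    · rw [← h]; field_simp; ring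
  · rw [hess_apply, quad_param, cubic_param]
    refine ⟨fun h => ?_, fun h => ?_⟩
    · linear_combination h
    · linear_combination h

/-! ### Invertibility of the Hessian and the branch of critical points -/

/-- If the state equation is solvable, then the Hessian is invertible as soon as the Hessian
system is uniquely solvable for right-hand sides acting on the parameter only: other right-hand
sides are removed by solving state equations. -/
theorem isInvertible_hess [CompleteSpace E] [CompleteSpace H] (hN : 0 < N) (s : Point E H N)
    (hA : ∀ F : H →L[ℝ] ℝ, ∃ u, ∀ u', A.stiff u u' - A.prod s.1 u u' = F u')
    (hH : ∀ F : E →L[ℝ] ℝ, ∃! a, A.hess s a = F ∘L prM) : (A.hess s).IsInvertible := by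
  refine ContinuousLinearMap.isInvertible_of_bijective ⟨fun a b hab => ?_, fun Ψ => ?_⟩
  · obtain ⟨c, -, hc⟩ := hH 0
    have h0 : A.hess s (a - b) = (0 : E →L[ℝ] ℝ) ∘L prM := by
      rw [map_sub, hab, sub_self, ContinuousLinearMap.zero_comp]
    have h1 : A.hess s 0 = (0 : E →L[ℝ] ℝ) ∘L prM := by
      rw [map_zero, ContinuousLinearMap.zero_comp]
    exact sub_eq_zero.1 ((hc _ h0).trans (hc _ h1).symm)
  · let inU : Fin N → H →L[ℝ] Point E H N := fun i => ContinuousLinearMap.inr ℝ _ _ ∘L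
      ContinuousLinearMap.inl ℝ _ _ ∘L ContinuousLinearMap.single ℝ (fun _ => H) i
    let inP : Fin N → H →L[ℝ] Point E H N := fun i => ContinuousLinearMap.inr ℝ _ _ ∘L
      ContinuousLinearMap.inr ℝ _ _ ∘L ContinuousLinearMap.single ℝ (fun _ => H) i
    have hu : ∀ i, ∃ u, ∀ p, A.stiff u p - A.prod s.1 u p = N * Ψ (0, 0, Pi.single i p) :=
      fun i => hA ((N : ℝ) • Ψ ∘L inP i)
    choose u hu using hu
    have hp : ∀ i, ∃ p, ∀ u', A.stiff p u' - A.prod s.1 p u'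
        = N * Ψ (0, Pi.single i u', 0) - A.obs (u i) u' :=
      fun i => hA ((N : ℝ) • Ψ ∘L inU i - A.obs (u i))
    choose p hp using hp
    let r : Point E H N := (0, u, p)
    let F : E →L[ℝ] ℝ := (Ψ - A.hess s r) ∘L ContinuousLinearMap.inl ℝ _ _
    obtain ⟨a, ha, -⟩ := hH F
    refine ⟨a + r, ?_⟩
    -- `r` solves the equations of states and adjoint states, so only the parameter part is left
    have hr : Ψ - A.hess s r = F ∘L prM := by
      have h := (A.hess_eq_iff hN s r (Ψ - F ∘L prM)).2
        ⟨fun i p' => ?_, fun i u' => ?_, fun m => ?_⟩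
      · rw [h]; abel
      · have hF : F (prM ((0, 0, Pi.single i p') : Point E H N)) = 0 := map_zero F
        simp only [r, map_zero, zero_apply, sub_zero, sub_apply, ContinuousLinearMap.comp_apply,
          hF, hu]
      · have hF : F (prM ((0, Pi.single i u', 0) : Point E H N)) = 0 := map_zero F
        simp only [r, map_zero, zero_apply, sub_zero, sub_apply, ContinuousLinearMap.comp_apply,
          hF, hp]
        ring
      · have hF : (F ∘L prM) ((m, 0, 0) : Point E H N)
            = Ψ (m, 0, 0) - A.hess s r (m, 0, 0) := rfl
        rw [sub_apply, hF, hess_apply, quad_param, cubic_param]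
        ring
    rw [map_add, ha, ← hr]
    abel

/-- Through a nondegenerate solution of the first-order system passes one branch of solutions, along
which the Hessian stays invertible. -/
theorem exists_branch [CompleteSpace E] [CompleteSpace H]
    {φ δ : Fin N → W →L[ℝ] H →L[ℝ] ℝ} {μ : E} {w₀ : W} {s₀ : Point E H N}
    (hinv : (A.hess s₀).IsInvertible) (h₀ : A.first μ s₀ = load φ δ w₀) :
    ∃ σ : W → Point E H N, σ w₀ = s₀ ∧ Tendsto σ (𝓝 w₀) (𝓝 s₀) ∧
      (∀ᶠ w in 𝓝 w₀, A.first μ (σ w) = load φ δ w ∧ (A.hess (σ w)).IsInvertible) ∧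
      ∀ τ : W → Point E H N, Tendsto τ (𝓝 w₀) (𝓝 s₀) →
        (∀ᶠ w in 𝓝 w₀, A.first μ (τ w) = load φ δ w) → τ =ᶠ[𝓝 w₀] σ := by
  obtain ⟨σ, σ', hσ₀, hd, -, hσ, huniq⟩ :=
    exists_branch_cubicGrad A.cubic_comm_left hinv (load φ δ) h₀
  have hlim : Tendsto σ (𝓝 w₀) (𝓝 s₀) := hσ₀ ▸ hd.continuousAt.tendsto
  exact ⟨σ, hσ₀, hlim,
    hσ.and (hinv.eventually ((continuous_cubicHess.tendsto s₀).comp hlim)), huniq⟩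

-- needed for the topological group structure of spaces of bilinear forms
set_option maxSynthPendingDepth 2 in
/-- Along solutions of the first-order system, continuity of the parameter gives continuity of the
states and adjoint states. -/
theorem tendsto_of_tendsto_param [CompleteSpace H] (hN : 0 < N)
    {φ δ : Fin N → W →L[ℝ] H →L[ℝ] ℝ} {μ : E} {w₀ : W} {s₀ : Point E H N}
    (hA : (A.stiff - A.prod s₀.1).IsInvertible) (h₀ : A.first μ s₀ = load φ δ w₀)
    {τ : W → Point E H N} (hτ : Tendsto (fun w => (τ w).1) (𝓝 w₀) (𝓝 s₀.1))
    (h : ∀ᶠ w in 𝓝 w₀, A.first μ (τ w) = load φ δ w) : Tendsto τ (𝓝 w₀) (𝓝 s₀) := by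
  simp only [A.first_eq_load_iff hN] at h h₀
  have hop : Tendsto (fun w => A.stiff - A.prod (τ w).1) (𝓝 w₀) (𝓝 (A.stiff - A.prod s₀.1)) :=
    tendsto_const_nhds.sub ((A.prod.continuous.tendsto _).comp hτ)
  have hu : ∀ i, Tendsto (fun w => (τ w).2.1 i) (𝓝 w₀) (𝓝 (s₀.2.1 i)) := by
    intro i
    refine tendsto_of_eventually_apply_eq hA hop ((φ i).continuous.tendsto w₀) ?_ ?_
    · filter_upwards [h] with w hw
      exact ContinuousLinearMap.ext fun p => hw.1 i p
    · exact ContinuousLinearMap.ext fun p => h₀.1 i p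
  have hp : ∀ i, Tendsto (fun w => (τ w).2.2 i) (𝓝 w₀) (𝓝 (s₀.2.2 i)) := by
    intro i
    refine tendsto_of_eventually_apply_eq hA hop (b := fun w => δ i w - A.obs ((τ w).2.1 i))
      (((δ i).continuous.tendsto w₀).sub ((A.obs.continuous.tendsto _).comp (hu i))) ?_ ?_
    · filter_upwards [h] with w hw
      exact ContinuousLinearMap.ext fun u => eq_sub_of_add_eq (hw.2.1 i u)
    · exact ContinuousLinearMap.ext fun u => eq_sub_of_add_eq (h₀.2.1 i u)
  exact hτ.prodMk_nhds ((tendsto_pi_nhds.2 hu).prodMk_nhds (tendsto_pi_nhds.2 hp))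

/-- Derivative of the trace estimator along a branch: the multiplier `σ` replaces the derivative of
the branch, by symmetry of the Hessian. -/
theorem hasFDerivAt_trace [CompleteSpace E] [CompleteSpace H] {n : ℕ}
    {φ δ : Fin N → W →L[ℝ] H →L[ℝ] ℝ} {μ : E} {w₀ : W} {s : W → Point E H N}
    (hinv : (A.hess (s w₀)).IsInvertible) (hs : ContinuousAt s w₀)
    (hfirst : ∀ᶠ w in 𝓝 w₀, A.first μ (s w) = load φ δ w)
    {ℓ : Fin n → Point E H N →L[ℝ] ℝ} {h : W → Fin n → Point E H N}
    (hh : ∀ᶠ w in 𝓝 w₀, ∀ k, A.hess (s w) (h w k) = ℓ k) {σ : Point E H N}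
    (hσ : A.hess (s w₀) σ = (1 / (n : ℝ)) • ∑ k, A.cubic N (h w₀ k) (h w₀ k)) :
    HasFDerivAt (fun w => 1 / (n : ℝ) * ∑ k, ℓ k (h w k)) (-(load φ δ).flip σ) w₀ := by
  obtain ⟨ς, ς', h0, hd, hς', -, huniq⟩ := exists_branch_cubicGrad A.cubic_comm_left hinv
    (load φ δ) hfirst.self_of_nhds
  have hsd : HasFDerivAt s ς' w₀ := hd.congr_of_eventuallyEq (huniq s hs hfirst)
  have hk : ∀ k, HasFDerivAt (fun w => ℓ k (h w k))
      (-(((A.cubic N).flip (h w₀ k)).flip (h w₀ k) ∘L ς')) w₀ := fun k =>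
    hasFDerivAt_apply_cubicHess_solution (h := fun w => h w k) A.quad_comm A.cubic_comm_right hsd
      hinv (hh.mono fun w hw => hw k)
  have hsum := (HasFDerivAt.fun_sum fun k (_ : k ∈ Finset.univ) => hk k).const_mul (1 / (n : ℝ))
  refine hsum.congr_fderiv (ContinuousLinearMap.ext fun w => ?_)
  have e : load φ δ w σ = A.hess (s w₀) σ (ς' w) := by
    rw [A.hess_comm, ← hς' w]
    rfl
  have hc : ∀ a, A.cubic N (ς' w) a a = A.cubic N a a (ς' w) := fun a => by
    rw [A.cubic_comm_left, A.cubic_comm_right]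
  simp only [neg_apply, smul_apply, sum_apply, ContinuousLinearMap.flip_apply,
    ContinuousLinearMap.comp_apply, e, hσ, hc, smul_eq_mul, Finset.sum_neg_distrib, mul_neg]

/-! ### Stationarity of the Lagrangian -/

/-- The Lagrangian of the trace estimator under the optimality constraints, with multiplier `σ` for
the first-order system `first μ s = c` and `η k` for the Hessian system `hess s (h k) = ℓ k`. -/
def lagr {n : ℕ} (μ : E) (c : Point E H N →L[ℝ] ℝ) (ℓ : Fin n → Point E H N →L[ℝ] ℝ)
    (s : Point E H N) (h : Fin n → Point E H N) (σ : Point E H N) (η : Fin n → Point E H N) : ℝ :=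
  1 / (n : ℝ) * ∑ k, ℓ k (h k) + 1 / (n : ℝ) * ∑ k, (A.hess s (h k) (η k) - ℓ k (η k))
    + (A.first μ s σ - c σ)

section Lagrangian

variable {n : ℕ} {μ : E} {c : Point E H N →L[ℝ] ℝ} {ℓ : Fin n → Point E H N →L[ℝ] ℝ}
  {s : Point E H N} {h : Fin n → Point E H N} {σ : Point E H N} {η : Fin n → Point E H N}

/-- Derivative of the Lagrangian in the variables of the first-order system. -/
theorem hasDerivAt_lagr_point (s' : Point E H N) :
    HasDerivAt (fun t : ℝ => A.lagr μ c ℓ (s + t • s') h σ η)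
      ((A.hess s σ + (1 / (n : ℝ)) • ∑ k, A.cubic N (h k) (η k)) s') 0 := by
  have hcub : ∀ k, A.cubic N s' (h k) (η k) = A.cubic N (h k) (η k) s' := fun k => by
    rw [A.cubic_comm_left, A.cubic_comm_right]
  have e : (fun t : ℝ => A.lagr μ c ℓ (s + t • s') h σ η) = fun t : ℝ => A.lagr μ c ℓ s h σ η
      + t * (A.hess s σ + (1 / (n : ℝ)) • ∑ k, A.cubic N (h k) (η k)) s'
      + t ^ 2 * (1 / 2 * A.cubic N s' s' σ) := by
    funext t
    rw [add_apply, A.hess_comm]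
    simp only [lagr, hess_apply, first_apply, map_add, map_smul, add_apply, smul_apply,
      sum_apply, smul_eq_mul, A.cubic_comm_left s' s, ← hcub, Finset.sum_add_distrib,
      Finset.sum_sub_distrib, ← Finset.mul_sum]
    ring
  rw [e]
  have h1 := (((hasDerivAt_id (0 : ℝ)).mul_const
    ((A.hess s σ + (1 / (n : ℝ)) • ∑ k, A.cubic N (h k) (η k)) s')).const_add
    (A.lagr μ c ℓ s h σ η)).add (((hasDerivAt_id (0 : ℝ)).pow 2).mul_const
      (1 / 2 * A.cubic N s' s' σ))
  refine h1.congr_deriv ?_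
  simp

/-- Derivative of the Lagrangian in the variables of the Hessian systems, in which it is affine. -/
theorem hasDerivAt_lagr_incr (h' : Fin n → Point E H N) :
    HasDerivAt (fun t : ℝ => A.lagr μ c ℓ s (h + t • h') σ η)
      (1 / (n : ℝ) * ∑ k, (A.hess s (η k) + ℓ k) (h' k)) 0 := by
  have e : (fun t : ℝ => A.lagr μ c ℓ s (h + t • h') σ η) = fun t : ℝ => A.lagr μ c ℓ s h σ η
      + t * (1 / (n : ℝ) * ∑ k, (A.hess s (η k) + ℓ k) (h' k)) := by
    funext t
    simp only [add_apply, A.hess_comm s (η _)]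
    simp only [lagr, Pi.add_apply, Pi.smul_apply, map_add, map_smul, add_apply, smul_apply,
      smul_eq_mul, Finset.sum_add_distrib, Finset.sum_sub_distrib, ← Finset.mul_sum]
    ring
  rw [e]
  have h1 := ((hasDerivAt_id (0 : ℝ)).mul_const
    (1 / (n : ℝ) * ∑ k, (A.hess s (η k) + ℓ k) (h' k))).const_add (A.lagr μ c ℓ s h σ η)
  refine h1.congr_deriv ?_
  simp

/-- Stationarity in each of the six groups of variables determines the multipliers. -/
theorem stationary_lagr_iff (hn : 0 < n) (hinj : Function.Injective (A.hess s))
    (hh : ∀ k, A.hess s (h k) = ℓ k) :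
    ((∀ m', HasDerivAt (fun t : ℝ => A.lagr μ c ℓ (s + t • (m', 0, 0)) h σ η) 0 0) ∧
    (∀ u', HasDerivAt (fun t : ℝ => A.lagr μ c ℓ (s + t • (0, u', 0)) h σ η) 0 0) ∧
    (∀ p', HasDerivAt (fun t : ℝ => A.lagr μ c ℓ (s + t • (0, 0, p')) h σ η) 0 0) ∧
    (∀ v' : Fin N → Fin n → H, HasDerivAt (fun t : ℝ => A.lagr μ c ℓ s
      (h + t • fun k => ((0, fun i => v' i k, 0) : Point E H N)) σ η) 0 0) ∧
    (∀ q' : Fin N → Fin n → H, HasDerivAt (fun t : ℝ => A.lagr μ c ℓ s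
      (h + t • fun k => ((0, 0, fun i => q' i k) : Point E H N)) σ η) 0 0) ∧
    (∀ y' : Fin n → E, HasDerivAt (fun t : ℝ => A.lagr μ c ℓ s
      (h + t • fun k => ((y' k, 0, 0) : Point E H N)) σ η) 0 0)) ↔
    (∀ k, h k = -η k) ∧ A.hess s σ = (1 / (n : ℝ)) • ∑ k, A.cubic N (h k) (h k) := by
  have hn' : (1 / (n : ℝ)) ≠ 0 := by positivity
  have hpt : ∀ s', HasDerivAt (fun t : ℝ => A.lagr μ c ℓ (s + t • s') h σ η) 0 0 ↔
      (A.hess s σ + (1 / (n : ℝ)) • ∑ k, A.cubic N (h k) (η k)) s' = 0 := fun s' =>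
    ⟨fun H => (A.hasDerivAt_lagr_point s').unique H,
      fun H => (A.hasDerivAt_lagr_point s').congr_deriv H⟩
  have hinc : ∀ h', HasDerivAt (fun t : ℝ => A.lagr μ c ℓ s (h + t • h') σ η) 0 0 ↔
      1 / (n : ℝ) * ∑ k, (A.hess s (η k) + ℓ k) (h' k) = 0 := fun h' =>
    ⟨fun H => (A.hasDerivAt_lagr_incr h').unique H,
      fun H => (A.hasDerivAt_lagr_incr h').congr_deriv H⟩
  simp only [hpt, hinc, mul_eq_zero, hn', false_or]
  -- stationarity in `v`, `q`, `y` means that `-η k` solves the Hessian system of `h k`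
  have key : ∀ k, A.hess s (η k) + ℓ k = 0 ↔ h k = -η k := fun k => by
    rw [← hh k, ← map_add]
    refine ⟨fun H => eq_neg_of_add_eq_zero_right (hinj (H.trans (map_zero _).symm)), fun H => ?_⟩
    rw [H, add_neg_cancel, map_zero]
  have hcub : (∀ k, h k = -η k) → (A.hess s σ + (1 / (n : ℝ)) • ∑ k, A.cubic N (h k) (η k) = 0 ↔
      A.hess s σ = (1 / (n : ℝ)) • ∑ k, A.cubic N (h k) (h k)) := fun H => by
    have : ∀ k, A.cubic N (h k) (η k) = -A.cubic N (h k) (h k) := fun k => by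
      rw [← map_neg]
      congr 1
      rw [H k, neg_neg]
    simp only [this, Finset.sum_neg_distrib, smul_neg, ← sub_eq_add_neg, sub_eq_zero]
  constructor
  · rintro ⟨h1, h2, h3, h4, h5, h6⟩
    have hη : ∀ k, h k = -η k := by
      intro k
      rw [← key k]
      have hall : ∀ h' : Fin n → Point E H N, ∑ k, (A.hess s (η k) + ℓ k) (h' k) = 0 := by
        intro h'
        have e : ∀ k, h' k = (0, fun i => (h' k).2.1 i, 0) + (0, 0, fun i => (h' k).2.2 i)
            + ((h' k).1, 0, 0) := fun k => by
          refine Prod.ext ?_ (Prod.ext ?_ ?_) <;> simp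
        have := congrArg₂ (· + ·) (congrArg₂ (· + ·) (h4 fun i k => (h' k).2.1 i)
          (h5 fun i k => (h' k).2.2 i)) (h6 fun k => (h' k).1)
        simp only [← Finset.sum_add_distrib, ← map_add, ← e, add_zero] at this
        exact this
      refine ContinuousLinearMap.ext fun b => ?_
      have := hall (Pi.single k b)
      rw [Finset.sum_eq_single k, Pi.single_eq_same] at this
      · exact this
      · intro j _ hj
        rw [Pi.single_eq_of_ne hj, map_zero]
      · simp
    refine ⟨hη, (hcub hη).1 (ext_components h1 ?_ ?_)⟩
    · exact fun i u => h2 _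
    · exact fun i p => h3 _
  · rintro ⟨hη, hσ⟩
    have h1 := (hcub hη).2 hσ
    have h2 := fun k => (key k).2 (hη k)
    simp only [h1, h2, zero_apply, Finset.sum_const_zero, implies_true, and_self]

/-- `stationary_lagr_iff` for a function of the six groups of variables. -/
theorem stationary_iff_of_eq_lagr (hn : 0 < n)
    {L : E → (Fin N → H) → (Fin N → H) → (Fin N → Fin n → H) → (Fin N → Fin n → H) →
      (Fin n → E) → ℝ}
    {ms : E} {us ps : Fin N → H} {vs qs : Fin N → Fin n → H} {ys : Fin n → E}
    (hL : ∀ m u p v q y, L m u p v q y = A.lagr μ c ℓ (m, u, p)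
      (fun k => (y k, fun i => v i k, fun i => q i k)) (ms, ps, us)
      (fun k => (ys k, fun i => qs i k, fun i => vs i k)))
    {m : E} {u p : Fin N → H} {v q : Fin N → Fin n → H} {y : Fin n → E}
    (hinj : Function.Injective (A.hess (m, u, p)))
    (hh : ∀ k, A.hess (m, u, p) (y k, fun i => v i k, fun i => q i k) = ℓ k) :
    ((∀ m', HasDerivAt (fun t : ℝ => L (m + t • m') u p v q y) 0 0) ∧
    (∀ u', HasDerivAt (fun t : ℝ => L m (u + t • u') p v q y) 0 0) ∧
    (∀ p', HasDerivAt (fun t : ℝ => L m u (p + t • p') v q y) 0 0) ∧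
    (∀ v', HasDerivAt (fun t : ℝ => L m u p (v + t • v') q y) 0 0) ∧
    (∀ q', HasDerivAt (fun t : ℝ => L m u p v (q + t • q') y) 0 0) ∧
    (∀ y', HasDerivAt (fun t : ℝ => L m u p v q (y + t • y')) 0 0)) ↔
    (∀ k, y k = -ys k) ∧ (∀ i k, v i k = -qs i k) ∧ (∀ i k, q i k = -vs i k) ∧
    A.hess (m, u, p) (ms, ps, us) = (1 / (n : ℝ)) • ∑ k,
      A.cubic N (y k, fun i => v i k, fun i => q i k) (y k, fun i => v i k, fun i => q i k) := by
  have h := A.stationary_lagr_iff (μ := μ) (c := c) (s := (m, u, p)) (σ := (ms, ps, us))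
    (η := fun k => (ys k, fun i => qs i k, fun i => vs i k)) hn hinj hh
  have hadd : ∀ (a b : Fin n → Point E H N) (t : ℝ), a + t • b = fun k => a k + t • b k :=
    fun _ _ _ => rfl
  simp only [hadd, Prod.smul_mk, Prod.mk_add_mk, smul_zero, add_zero] at h
  simp only [hL]
  refine Iff.trans h ⟨fun ⟨h1, h2⟩ => ?_, fun ⟨h1, h2, h3, h4⟩ => ⟨fun k => ?_, h4⟩⟩
  · exact ⟨fun k => congrArg Prod.fst (h1 k),
      fun i k => congrFun (congrArg (fun s => s.2.1) (h1 k)) i,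
      fun i k => congrFun (congrArg (fun s => s.2.2) (h1 k)) i, h2⟩
  · exact Prod.ext (h1 k) (Prod.ext (funext fun i => h2 i k) (funext fun i => h3 i k))

end Lagrangian

/-! ### Optimality systems written with concrete forms -/

/-- The bounded forms `A` are given by the state form `helm`, the product form `tri` scaled by
`κ²`, and the observation `B` with noise-weighted product `noise`. -/
structure Represents {E H V : Type*} [NormedAddCommGroup E] [InnerProductSpace ℝ E]
    [NormedAddCommGroup H] [NormedSpace ℝ H] [AddCommGroup V] (A : InverseForms E H) (κ : ℝ)
    (helm tri : E → H → H → ℝ) (noise : V → V → ℝ) (B : H → V) : Prop where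
  prior : ∀ x y, A.prior x y = inner ℝ x y
  helm : ∀ m u v, helm m u v = A.stiff u v - A.prod m u v
  prod : ∀ a u v, A.prod a u v = κ ^ 2 * tri a u v
  obs : ∀ u v, A.obs u v = noise (B u) (B v)
  tri_comm : ∀ a u v, tri a u v = tri a v u
  noise_comm : ∀ a b, noise a b = noise b a
  noise_sub : ∀ a b c, noise a (b - c) = noise a b - noise a c

namespace Represents

variable {E H V W : Type*} [NormedAddCommGroup E] [InnerProductSpace ℝ E]
  [NormedAddCommGroup H] [NormedSpace ℝ H] [AddCommGroup V] [NormedAddCommGroup W] [NormedSpace ℝ W]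
  {A : InverseForms E H} {κ : ℝ} {helm tri : E → H → H → ℝ} {noise : V → V → ℝ} {B : H → V}
  (R : A.Represents κ helm tri noise B) {N n : ℕ}

include R

theorem helm_comm (m : E) (u v : H) : helm m u v = helm m v u := by
  rw [R.helm, R.helm, A.stiff_comm, A.prod_comm]

/-- The first-order system in weak form. -/
theorem firstOrder_iff (hN : 0 < N) {φ δ : Fin N → W →L[ℝ] H →L[ℝ] ℝ} {w : W}
    {src : Fin N → H → ℝ} {dat : Fin N → V} (hφ : ∀ i p, φ i w p = src i p)
    (hδ : ∀ i u, δ i w u = noise (B u) (dat i)) (μ m : E) (u p : Fin N → H) :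
    ((∀ i, ∀ p', helm m (u i) p' - src i p' = 0) ∧
      (∀ i, ∀ u', helm m u' (p i) + noise (B u') (B (u i) - dat i) = 0) ∧
      (∀ m', inner ℝ (m - μ) m' - 1 / (N : ℝ) * ∑ i, κ ^ 2 * tri m' (u i) (p i) = 0)) ↔
    A.first μ (m, u, p) = load φ δ w := by
  rw [first_eq_load_iff _ hN]
  refine and_congr (forall₂_congr fun i p' => ?_) (and_congr (forall₂_congr fun i u' => ?_)
    (forall_congr' fun m' => ?_))
  · rw [R.helm, hφ, sub_eq_zero]
  · rw [R.helm_comm, R.helm, R.noise_sub, hδ, R.obs, R.noise_comm (B u') (B (u i)),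
      ← sub_eq_zero (b := noise _ (dat i)), add_sub_assoc]
  · simp only [R.prod, R.prior]

/-- The Hessian system in weak form. -/
theorem hessianSystem_iff (hN : 0 < N) (m y : E) (u p v q : Fin N → H) {F : E →L[ℝ] ℝ}
    {G : E → ℝ} (hF : ∀ m, F m = G m) :
    ((∀ i, ∀ p', helm m (v i) p' - κ ^ 2 * tri y (u i) p' = 0) ∧
      (∀ i, ∀ u', helm m u' (q i) - κ ^ 2 * tri y u' (p i) + noise (B u') (B (v i)) = 0) ∧
      (∀ m', inner ℝ y m'
        - 1 / (N : ℝ) * ∑ i, κ ^ 2 * (tri m' (v i) (p i) + tri m' (u i) (q i)) = G m')) ↔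
    A.hess (m, u, p) (y, v, q) = F ∘L prM := by
  rw [hess_eq_iff _ hN]
  refine and_congr (forall₂_congr fun i p' => ?_) (and_congr (forall₂_congr fun i u' => ?_)
    (forall_congr' fun m' => ?_))
  · have h : (F ∘L prM) ((0, 0, Pi.single i p') : Point E H N) = 0 := map_zero F
    rw [h, R.helm, R.prod y, mul_zero]
  · have h : (F ∘L prM) ((0, Pi.single i u', 0) : Point E H N) = 0 := map_zero F
    rw [h, R.helm_comm, R.helm, R.prod y, R.obs, mul_zero, R.tri_comm y u', R.noise_comm (B u')]
  · have h : (F ∘L prM) ((m', 0, 0) : Point E H N) = G m' := hF m'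
    simp only [h, R.prod, R.prior, mul_add, add_comm]

/-- The adjoint system in weak form: `ps` stands in the place of the states and `us` in the place of
the adjoint states. -/
theorem adjointSystem_iff (hN : 0 < N) (m ms : E) (u p us ps : Fin N → H) (y : Fin n → E)
    (v q : Fin N → Fin n → H) :
    ((∀ i, ∀ p', helm m (ps i) p' - κ ^ 2 * tri ms (u i) p'
        = -(2 / (n : ℝ)) * ∑ k, κ ^ 2 * tri (y k) (v i k) p') ∧
      (∀ i, ∀ u', helm m (us i) u' - κ ^ 2 * tri ms (p i) u' + noise (B (ps i)) (B u')
        = -(2 / (n : ℝ)) * ∑ k, κ ^ 2 * tri (y k) (q i k) u') ∧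
      (∀ m', inner ℝ ms m'
        - 1 / (N : ℝ) * ∑ i, κ ^ 2 * (tri m' (u i) (us i) + tri m' (ps i) (p i))
        = -(2 / ((n : ℝ) * (N : ℝ))) * ∑ k, ∑ i, κ ^ 2 * tri m' (v i k) (q i k))) ↔
    A.hess (m, u, p) (ms, ps, us) = (1 / (n : ℝ)) • ∑ k,
      A.cubic N (y k, fun i => v i k, fun i => q i k) (y k, fun i => v i k, fun i => q i k) := by
  have hN' : (N : ℝ) ≠ 0 := by positivity
  have hN1 : (N : ℝ) * (1 / (N : ℝ)) = 1 := by field_simp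
  rw [hess_eq_iff _ hN]
  refine and_congr (forall₂_congr fun i p' => ?_) (and_congr (forall₂_congr fun i u' => ?_)
    (forall_congr' fun m' => ?_))
  · rw [R.helm, R.prod ms]
    simp only [smul_apply, sum_apply, cubic_adjoint, R.prod, smul_eq_mul, ← Finset.mul_sum,
      Finset.sum_add_distrib]
    refine Eq.congr_right ?_
    linear_combination (-(2 / (n : ℝ)) * (κ ^ 2 * ∑ k, tri (y k) (v i k) p')) * (-hN1)
  · rw [R.helm, R.prod ms, R.obs]
    simp only [smul_apply, sum_apply, cubic_state, R.prod, smul_eq_mul, ← Finset.mul_sum,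
      Finset.sum_add_distrib]
    refine Eq.congr_right ?_
    linear_combination (-(2 / (n : ℝ)) * (κ ^ 2 * ∑ k, tri (y k) (q i k) u')) * (-hN1)
  · simp only [smul_apply, sum_apply, cubic_param, R.prod, R.prior, smul_eq_mul,
      ← Finset.mul_sum, Finset.sum_add_distrib, mul_add]
    refine Eq.congr_right ?_
    ring

theorem lagrangian_eq {φ δ : Fin N → W →L[ℝ] H →L[ℝ] ℝ} {w : W}
    {src : Fin N → H → ℝ} {dat : Fin N → V} (hφ : ∀ i p, φ i w p = src i p)
    (hδ : ∀ i u, δ i w u = noise (B u) (dat i)) {F : Fin n → E →L[ℝ] ℝ} {G G' : Fin n → E → ℝ}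
    (hG : ∀ k a, F k a = G k a) (hG' : ∀ k a, F k a = G' k a)
    (μ m ms : E) (u p us ps : Fin N → H) (y ys : Fin n → E) (v q vs qs : Fin N → Fin n → H) :
    1 / (n : ℝ) * ∑ k, G k (y k)
      + 1 / ((n : ℝ) * (N : ℝ)) * ∑ k, ∑ i,
          (helm m (v i k) (vs i k) - κ ^ 2 * tri (y k) (u i) (vs i k))
      + 1 / ((n : ℝ) * (N : ℝ)) * ∑ k, ∑ i,
          (helm m (qs i k) (q i k) - κ ^ 2 * tri (y k) (qs i k) (p i)
            + noise (B (qs i k)) (B (v i k)))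
      + 1 / (n : ℝ) * ∑ k, (inner ℝ (y k) (ys k)
          - 1 / (N : ℝ) * ∑ i, κ ^ 2 *
              (tri (ys k) (v i k) (p i) + tri (ys k) (u i) (q i k))
          - G' k (ys k))
      + 1 / (N : ℝ) * ∑ i, (helm m (u i) (us i) - src i (us i))
      + 1 / (N : ℝ) * ∑ i, (helm m (ps i) (p i) + noise (B (ps i)) (B (u i) - dat i))
      + (inner ℝ (m - μ) ms - 1 / (N : ℝ) * ∑ i, κ ^ 2 * tri ms (u i) (p i))
    = A.lagr μ (load φ δ w) (fun k => F k ∘L prM) (m, u, p)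
        (fun k => (y k, fun i => v i k, fun i => q i k)) (ms, ps, us)
        (fun k => (ys k, fun i => qs i k, fun i => vs i k)) := by
  have hF : ∀ k, ∀ s : Point E H N, (F k ∘L prM) s = F k s.1 := fun _ _ => rfl
  simp only [lagr, hess_apply, first_apply, quad_apply, cubic_apply, load_apply, hF, ← hG, ← hG',
    ← hφ, R.helm, ← R.prod, R.noise_sub, ← R.obs, hδ, mul_add (κ ^ 2), ← R.prior, map_sub,
      sub_apply,
    A.stiff_comm (qs _ _), A.stiff_comm (ps _), A.obs_comm (qs _ _), A.obs_comm (ps _),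
    Finset.sum_add_distrib, Finset.sum_sub_distrib, ← Finset.mul_sum]
  ring

end Represents

end InverseForms

/-! ### The Helmholtz problem in terms of its forms -/

namespace AOptHelmholtz

open InverseForms

variable {d : ℕ} {D : Set (Space d)} {q Ns Nw ntr : ℕ}

namespace Vars

variable {P : Problem D q Ns}

/-- The variables of the first-order system. -/
def point (X : Vars P Nw ntr) : Point P.prior.CM (State D) Nw := (X.m, X.u, X.p)

/-- The variables of the `k`-th Hessian system. -/
def incr (X : Vars P Nw ntr) (k : Fin ntr) : Point P.prior.CM (State D) Nw :=
  (X.y k, fun i => X.v i k, fun i => X.q i k)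

/-- The multipliers of the first-order system, in the position of the test functions that they
replace: `p*` tests the adjoint equation and `u*` the state equation. -/
def pointMult (Y : Vars P Nw ntr) : Point P.prior.CM (State D) Nw := (Y.m, Y.p, Y.u)

/-- The multipliers of the `k`-th Hessian system, in the position of the test functions that they
replace. -/
def incrMult (Y : Vars P Nw ntr) (k : Fin ntr) : Point P.prior.CM (State D) Nw :=
  (Y.y k, fun i => Y.q i k, fun i => Y.v i k)

/-- The variables with given `point` and `incr`. -/
def ofPoints (s : Point P.prior.CM (State D) Nw) (h : Fin ntr → Point P.prior.CM (State D) Nw) :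
    Vars P Nw ntr where
  m := s.1
  u := s.2.1
  p := s.2.2
  v := fun i k => (h k).2.1 i
  q := fun i k => (h k).2.2 i
  y := fun k => (h k).1

end Vars

namespace Problem

variable (P : Problem D q Ns)

/-- The observation operator on `State D`. -/
def obsL : State D →L[ℝ] EuclideanSpace ℝ (Fin q) := P.B

/-- The source `f_j` as a functional on `State D`. -/
def srcL (j : Fin Ns) : State D →L[ℝ] ℝ := P.f j

/-- The forms of the Helmholtz problem, for `τ` the form `κ² tri` as a bounded trilinear map. -/
def forms (τ : P.prior.CM →L[ℝ] State D →L[ℝ] State D →L[ℝ] ℝ)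
    (hτ : ∀ a u v, τ a u v = P.κ ^ 2 * P.tri a u v) : InverseForms P.prior.CM (State D) where
  prior := innerSL ℝ
  stiff := (innerSL ℝ (E := L2Vec D)).bilinearComp gradL gradL
  obs := P.noiseL.bilinearComp P.obsL P.obsL
  prod := τ
  prior_comm x y := real_inner_comm y x
  stiff_comm x y := real_inner_comm (gradL y) (gradL x)
  obs_comm x y := P.noiseL_comm (P.obsL x) (P.obsL y)
  prod_comm a x y :=
    (hτ a x y).trans ((congrArg (P.κ ^ 2 * ·) (P.tri_comm a x y)).trans (hτ a y x).symm)

theorem represents_forms {τ : P.prior.CM →L[ℝ] State D →L[ℝ] State D →L[ℝ] ℝ}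
    (hτ : ∀ a u v, τ a u v = P.κ ^ 2 * P.tri a u v) :
    (P.forms τ hτ).Represents P.κ P.helm P.tri P.noiseInner P.obsL where
  prior _ _ := rfl
  helm m u v := congrArg (inner ℝ (grad u) (grad v) - ·) (hτ m u v).symm
  prod := hτ
  obs _ _ := rfl
  tri_comm := P.tri_comm
  noise_comm := P.noiseL_comm
  noise_sub a b c := (P.noiseL a).map_sub b c

/-- The coordinate `w ↦ wⁱⱼ`. -/
def weightCoord (i : Fin Nw) (j : Fin Ns) : Weights Nw Ns →L[ℝ] ℝ :=
  (EuclideanSpace.proj j : EuclideanSpace ℝ (Fin Ns) →L[ℝ] ℝ) ∘L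
    PiLp.proj 2 (fun _ : Fin Nw => EuclideanSpace ℝ (Fin Ns)) i

/-- `encSource` as a bounded operator of the weights. -/
def sourceL (i : Fin Nw) : Weights Nw Ns →L[ℝ] State D →L[ℝ] ℝ :=
  ∑ j, (weightCoord i j).smulRight (P.srcL j)

/-- The functional `u ↦ ⟨B u, d(wⁱ)⟩` as a bounded operator of the weights. -/
def dataL (i : Fin Nw) : Weights Nw Ns →L[ℝ] State D →L[ℝ] ℝ :=
  ∑ j, (weightCoord i j).smulRight (P.noiseL.flip (P.data j) ∘L P.obsL)

theorem sourceL_apply (i : Fin Nw) (w : Weights Nw Ns) (u : State D) :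
    P.sourceL i w u = ∑ j, w i j * P.srcL j u := by
  simp only [sourceL, sum_apply]
  rfl

theorem encSource_apply (i : Fin Nw) (w : Weights Nw Ns) (u : State D) :
    P.encSource w i u = ∑ j, w i j * P.srcL j u :=
  sum_apply _ _ _

theorem dataL_apply (i : Fin Nw) (w : Weights Nw Ns) (u : State D) :
    P.dataL i w u = P.noiseInner (P.obsL u) (P.encData w i) := by
  simp only [← noiseL_apply, dataL, encData, sum_apply, ContinuousLinearMap.smulRight_apply,
    smul_apply, map_sum, map_smul, ContinuousLinearMap.comp_apply,
    ContinuousLinearMap.flip_apply]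
  rfl

/-- The functional `m' ↦ ⟨z, m'⟩` of `L²(D)` on the Cameron-Martin space. -/
def dirL (z : L2 D) : P.prior.CM →L[ℝ] ℝ := innerSL ℝ z ∘L P.prior.toL2L

theorem dirL_apply (z : L2 D) (m : P.prior.CM) : P.dirL z m = inner ℝ z (P.prior.toL2 m) :=
  congrArg (inner ℝ z) (P.prior.toL2L_apply m)

theorem sourceL_eq_encSource (i : Fin Nw) (w : Weights Nw Ns) (u : State D) :
    P.sourceL i w u = P.encSource w i u :=
  (P.sourceL_apply i w u).trans (P.encSource_apply i w u).symm

section Translation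

variable {τ : P.prior.CM →L[ℝ] State D →L[ℝ] State D →L[ℝ] ℝ}
  (hτ : ∀ a u v, τ a u v = P.κ ^ 2 * P.tri a u v)

theorem firstOrder_iff (hN : 0 < Nw) (w : Weights Nw Ns) (m : P.prior.CM)
    (u p : Fin Nw → State D) : P.FirstOrder w m u p ↔
      (P.forms τ hτ).first P.mean (m, u, p) = load P.sourceL P.dataL w :=
  (P.represents_forms hτ).firstOrder_iff hN (fun i p => P.sourceL_eq_encSource i w p)
    (fun i u => P.dataL_apply i w u) P.mean m u p

theorem feasible_iff (hN : 0 < Nw) (z : Fin ntr → L2 D) (w : Weights Nw Ns) (X : Vars P Nw ntr) :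
    P.Feasible z w X ↔
      (P.forms τ hτ).first P.mean X.point = load P.sourceL P.dataL w ∧
      ∀ k, (P.forms τ hτ).hess X.point (X.incr k) = P.dirL (z k) ∘L prM :=
  and_congr (P.firstOrder_iff hτ hN w X.m X.u X.p) (forall_congr' fun k =>
    (P.represents_forms hτ).hessianSystem_iff hN X.m (X.y k) X.u X.p (fun i => X.v i k)
      (fun i => X.q i k) (fun m => P.dirL_apply (z k) m))

theorem lagrangian_eq (z : Fin ntr → L2 D) (w : Weights Nw Ns) (X Y : Vars P Nw ntr) :
    P.lagrangian z w X Y = (P.forms τ hτ).lagr P.mean (load P.sourceL P.dataL w)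
      (fun k => P.dirL (z k) ∘L prM) X.point X.incr Y.pointMult Y.incrMult :=
  (P.represents_forms hτ).lagrangian_eq (fun i p => P.sourceL_eq_encSource i w p)
    (fun i u => P.dataL_apply i w u)
    (fun k m => (P.dirL_apply (z k) m).trans (real_inner_comm _ _))
    (fun k m => P.dirL_apply (z k) m) P.mean X.m Y.m X.u X.p Y.u Y.p X.y Y.y X.v X.q Y.v Y.q

theorem adjointSystem_iff (hN : 0 < Nw) (X : Vars P Nw ntr) (ms : P.prior.CM)
    (us ps : Fin Nw → State D) : P.AdjointSystem X ms us ps ↔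
      (P.forms τ hτ).hess X.point (ms, ps, us)
        = (1 / (ntr : ℝ)) • ∑ k, (P.forms τ hτ).cubic Nw (X.incr k) (X.incr k) :=
  (P.represents_forms hτ).adjointSystem_iff hN X.m ms X.u X.p us ps X.y X.v X.q

theorem stationary_iff (z : Fin ntr → L2 D) (w : Weights Nw Ns) (X Y : Vars P Nw ntr)
    (hN : 0 < Nw) (hn : 0 < ntr) (hX : P.Feasible z w X)
    (hinj : Function.Injective ((P.forms τ hτ).hess X.point)) :
    P.Stationary z w X Y ↔
      (∀ k, X.y k = -Y.y k) ∧ (∀ i k, X.v i k = -Y.q i k) ∧ (∀ i k, X.q i k = -Y.v i k) ∧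
      P.AdjointSystem X Y.m Y.u Y.p := by
  have h := (P.forms τ hτ).stationary_iff_of_eq_lagr hn
    (L := fun m u p v q y => P.lagrangian z w ⟨m, u, p, v, q, y⟩ Y)
    (fun m u p v q y => P.lagrangian_eq hτ z w ⟨m, u, p, v, q, y⟩ Y) hinj
    ((P.feasible_iff hτ hN z w X).1 hX).2
  exact h.trans (and_congr_right' (and_congr_right' (and_congr_right'
    (P.adjointSystem_iff hτ hN X Y.m Y.u Y.p).symm)))

/-- The trace term of the objective, in terms of the right-hand sides of the Hessian systems. -/
theorem objective_eq (z : Fin ntr → L2 D) (lam : ℝ) (w : Weights Nw Ns) (X : Vars P Nw ntr) :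
    P.objective z lam w X.y = 1 / (ntr : ℝ) * ∑ k, (P.dirL (z k) ∘L prM) (X.incr k)
      + lam / (2 * (Nw : ℝ)) * ∑ i, (‖w i‖ ^ 2 - 1) ^ 2 := by
  have h : ∀ k, (P.dirL (z k) ∘L prM) (X.incr k) = inner ℝ (P.prior.toL2 (X.y k)) (z k) :=
    fun k => (P.dirL_apply (z k) (X.y k)).trans (real_inner_comm _ _)
  simp only [h]
  rfl

end Translation

theorem hasFDerivAt_penalty (lam : ℝ) (w : Weights Nw Ns) :
    HasFDerivAt (fun w : Weights Nw Ns => lam / (2 * (Nw : ℝ)) * ∑ i, (‖w i‖ ^ 2 - 1) ^ 2)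
      (∑ i, (2 * lam / (Nw : ℝ) * (‖w i‖ ^ 2 - 1)) • (innerSL ℝ (w i) ∘L
        (PiLp.proj 2 (fun _ : Fin Nw => EuclideanSpace ℝ (Fin Ns)) i :
          Weights Nw Ns →L[ℝ] EuclideanSpace ℝ (Fin Ns)))) w := by
  have h : ∀ i : Fin Nw, HasFDerivAt (fun w : Weights Nw Ns => (‖w i‖ ^ 2 - 1) ^ 2) _ w :=
    fun i => ((((PiLp.proj 2 (fun _ : Fin Nw => EuclideanSpace ℝ (Fin Ns)) i :
      Weights Nw Ns →L[ℝ] EuclideanSpace ℝ (Fin Ns)).hasFDerivAt (x := w)).norm_sq).sub_const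
        (1 : ℝ)).pow 2
  refine ((HasFDerivAt.fun_sum fun i (_ : i ∈ Finset.univ) => h i).const_mul _).congr_fderiv ?_
  refine ContinuousLinearMap.ext fun w' => ?_
  simp only [smul_apply, sum_apply, smul_eq_mul, Finset.mul_sum, ContinuousLinearMap.comp_apply,
    PiLp.proj_apply]
  refine Finset.sum_congr rfl fun i _ => ?_
  simp only [nsmul_eq_mul, Nat.cast_ofNat]
  ring

/-- The gradient vector represents the derivative obtained from the multipliers. -/
theorem inner_gradVector (lam : ℝ) (w w' : Weights Nw Ns) (ms : P.prior.CM)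
    (us ps : Fin Nw → State D) :
    inner ℝ (P.gradVector lam w us ps) w' =
      -load P.sourceL P.dataL w' (ms, ps, us)
        + ∑ i, 2 * lam / (Nw : ℝ) * (‖w i‖ ^ 2 - 1) * inner ℝ (w i) (w' i) := by
  have h1 : ∀ i, P.sourceL i w' (us i) = ∑ j, w' i j * P.f j (us i) := fun i =>
    P.sourceL_apply i w' (us i)
  have h2 : ∀ i, P.dataL i w' (ps i) = ∑ j, w' i j * P.noiseInner (P.B (ps i)) (P.data j) :=
    fun i => by
      simp only [dataL, sum_apply]
      rfl
  have h3 := load_apply P.sourceL P.dataL w' (ms, ps, us)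
  simp only [h1, h2] at h3
  rw [h3]
  simp only [PiLp.inner_apply, gradVector, ← Finset.sum_add_distrib, Finset.mul_sum,
    ← Finset.sum_neg_distrib]
  refine Finset.sum_congr rfl fun i _ => Finset.sum_congr rfl fun j _ => ?_
  simp only [RCLike.inner_apply, conj_trivial]
  ring

/-! ### Branch, adjoint system and gradient -/

section Conclusions

variable {τ : P.prior.CM →L[ℝ] State D →L[ℝ] State D →L[ℝ] ℝ}
  (hτ : ∀ a (u v : State D), τ a u v = P.κ ^ 2 * P.tri a u v)

/-- Well-posedness of the Helmholtz problem, as invertibility of the operator. -/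
theorem isInvertible_helm (m : P.prior.CM)
    (hHelm : ∀ F : H1 D →L[ℝ] ℝ, ∃! u : H1 D, ∀ u' : H1 D, P.helm m u u' = F u') :
    ((P.forms τ hτ).stiff - (P.forms τ hτ).prod m).IsInvertible := by
  have hA : ∀ u u' : State D, ((P.forms τ hτ).stiff - (P.forms τ hτ).prod m) u u' = P.helm m u u' :=
    fun u u' => ((P.represents_forms hτ).helm m u u').symm
  refine ContinuousLinearMap.isInvertible_of_bijective ⟨fun u v huv => ?_, fun F => ?_⟩
  · obtain ⟨u₀, -, h₀⟩ := hHelm (((P.forms τ hτ).stiff - (P.forms τ hτ).prod m) v)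
    refine (h₀ u fun u' => ?_).trans (h₀ v fun u' => ?_).symm
    · exact (hA u u').symm.trans (congrArg (fun G : State D →L[ℝ] ℝ => G u') huv)
    · exact (hA v u').symm
  · obtain ⟨u, hu, -⟩ := hHelm F
    exact ⟨u, ContinuousLinearMap.ext fun u' => (hA u u').trans (hu u')⟩

/-- Unique solvability of the Hessian system, as invertibility of the operator. -/
theorem isInvertible_hess_forms (hN : 0 < Nw) (X : Vars P Nw ntr)
    (hHelm : ∀ F : H1 D →L[ℝ] ℝ, ∃! u : H1 D, ∀ u' : H1 D, P.helm X.m u u' = F u')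
    (hHess : ∀ F : P.prior.CM →L[ℝ] ℝ,
      ∃! s : P.prior.CM × (Fin Nw → H1 D) × (Fin Nw → H1 D),
        P.HessianSystem X.m X.u X.p F s.1 s.2.1 s.2.2) :
    ((P.forms τ hτ).hess X.point).IsInvertible := by
  have hiff : ∀ (F : P.prior.CM →L[ℝ] ℝ) (s : Point P.prior.CM (State D) Nw),
      P.HessianSystem X.m X.u X.p F s.1 s.2.1 s.2.2 ↔
        (P.forms τ hτ).hess X.point s = F ∘L prM := fun F s =>
    (P.represents_forms hτ).hessianSystem_iff hN X.m s.1 X.u X.p s.2.1 s.2.2 (fun _ => rfl)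
  refine isInvertible_hess _ hN X.point (fun F => ?_) fun F => ?_
  · obtain ⟨u, hu, -⟩ := hHelm F
    exact ⟨u, fun u' => ((P.represents_forms hτ).helm X.m u u').symm.trans (hu u')⟩
  · obtain ⟨s, hs, hs'⟩ := hHess F
    exact ⟨s, (hiff F s).1 hs, fun s' h => hs' s' ((hiff F s').2 h)⟩

/-- Along a branch, all variables of the first-order system are continuous at `w₀`. -/
theorem tendsto_point (hN : 0 < Nw) {z : Fin ntr → L2 D} {w₀ : Weights Nw Ns}
    {X₀ : Vars P Nw ntr} (hX₀ : P.Feasible z w₀ X₀)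
    (hinv : ((P.forms τ hτ).stiff - (P.forms τ hτ).prod X₀.m).IsInvertible)
    {X : Weights Nw Ns → Vars P Nw ntr} (hX : P.IsBranch z w₀ X₀ X) :
    Tendsto (fun w => (X w).point) (𝓝 w₀) (𝓝 X₀.point) := by
  refine tendsto_of_tendsto_param (P.forms τ hτ) hN hinv
    ((P.feasible_iff hτ hN z w₀ X₀).1 hX₀).1 ?_ ?_
  · have h := hX.continuousAt.tendsto
    rw [hX.base] at h
    exact h
  · exact hX.feasible.mono fun w hw => ((P.feasible_iff hτ hN z w (X w)).1 hw).1

theorem exists_branch (hN : 0 < Nw) {z : Fin ntr → L2 D} {w₀ : Weights Nw Ns}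
    {X₀ : Vars P Nw ntr} (hX₀ : P.Feasible z w₀ X₀)
    (hhelm : ((P.forms τ hτ).stiff - (P.forms τ hτ).prod X₀.m).IsInvertible)
    (hhess : ((P.forms τ hτ).hess X₀.point).IsInvertible) :
    ∃ X : Weights Nw Ns → Vars P Nw ntr, P.IsBranch z w₀ X₀ X ∧
      ∀ X' : Weights Nw Ns → Vars P Nw ntr, P.IsBranch z w₀ X₀ X' → X' =ᶠ[𝓝 w₀] X := by
  have hf := (P.feasible_iff hτ hN z w₀ X₀).1 hX₀
  obtain ⟨σ, hσ₀, hσc, hσ, huniq⟩ := (P.forms τ hτ).exists_branch hhess hf.1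
  -- off the neighbourhood where the Hessian is invertible, `inverse` is the junk value `0`
  let h : Weights Nw Ns → Fin ntr → Point P.prior.CM (State D) Nw := fun w k =>
    ((P.forms τ hτ).hess (σ w)).inverse (P.dirL (z k) ∘L prM)
  refine ⟨fun w => Vars.ofPoints (σ w) (h w), ⟨?_, ?_, ?_⟩, fun X' hX' => ?_⟩
  · have h₀ : h w₀ = X₀.incr := funext fun k => by
      change ((P.forms τ hτ).hess (σ w₀)).inverse (P.dirL (z k) ∘L prM) = X₀.incr k
      rw [hσ₀, ← hf.2 k, hhess.inverse_apply_self]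
    change Vars.ofPoints (σ w₀) (h w₀) = X₀
    rw [hσ₀, h₀]
    rfl
  · change Tendsto (fun w => (σ w).1) (𝓝 w₀) (𝓝 (σ w₀).1)
    rw [hσ₀]
    exact (continuous_fst.tendsto X₀.point).comp hσc
  · filter_upwards [hσ] with w ⟨hw, hiw⟩
    exact (P.feasible_iff hτ hN z w _).2 ⟨hw, fun k => hiw.self_apply_inverse _⟩
  · have hpt := huniq (fun w => (X' w).point) (P.tendsto_point hτ hN hX₀ hhelm hX')
      (hX'.feasible.mono fun w hw => ((P.feasible_iff hτ hN z w (X' w)).1 hw).1)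
    filter_upwards [hpt, hσ, hX'.feasible] with w hw ⟨_, hiw⟩ hfw
    have hin : (X' w).incr = h w := funext fun k => by
      have h1 := ((P.feasible_iff hτ hN z w (X' w)).1 hfw).2 k
      rw [hw] at h1
      change (X' w).incr k = ((P.forms τ hτ).hess (σ w)).inverse (P.dirL (z k) ∘L prM)
      rw [← h1, hiw.inverse_apply_self]
    change Vars.ofPoints (X' w).point (X' w).incr = Vars.ofPoints (σ w) (h w)
    rw [hw, hin]

/-- The adjoint system is the equation of the Hessian with a right-hand side that also acts on
states and adjoint states. -/
theorem existsUnique_adjointSystem (hN : 0 < Nw) (X : Vars P Nw ntr)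
    (hhess : ((P.forms τ hτ).hess X.point).IsInvertible) :
    ∃! s : P.prior.CM × (Fin Nw → H1 D) × (Fin Nw → H1 D), P.AdjointSystem X s.1 s.2.1 s.2.2 := by
  obtain ⟨a, ha⟩ := hhess.surjective
    ((1 / (ntr : ℝ)) • ∑ k, (P.forms τ hτ).cubic Nw (X.incr k) (X.incr k))
  refine ⟨(a.1, a.2.2, a.2.1), (P.adjointSystem_iff hτ hN X a.1 a.2.2 a.2.1).2 ha, ?_⟩
  rintro ⟨ms, us, ps⟩ hs
  have h := hhess.injective (((P.adjointSystem_iff hτ hN X ms us ps).1 hs).trans ha.symm)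
  rw [← h]

theorem hasGradientAt_objective (hN : 0 < Nw) {z : Fin ntr → L2 D} (lam : ℝ)
    {w₀ : Weights Nw Ns} {X₀ : Vars P Nw ntr} (hX₀ : P.Feasible z w₀ X₀)
    (hhelm : ((P.forms τ hτ).stiff - (P.forms τ hτ).prod X₀.m).IsInvertible)
    (hhess : ((P.forms τ hτ).hess X₀.point).IsInvertible)
    {ms : P.prior.CM} {us ps : Fin Nw → H1 D} (hadj : P.AdjointSystem X₀ ms us ps)
    {X : Weights Nw Ns → Vars P Nw ntr} (hX : P.IsBranch z w₀ X₀ X) :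
    HasGradientAt (fun w => P.objective z lam w (X w).y) (P.gradVector lam w₀ us ps) w₀ := by
  have hfeas : ∀ᶠ w in 𝓝 w₀, _ := hX.feasible.mono fun w hw =>
    (P.feasible_iff hτ hN z w (X w)).1 hw
  have hpt := P.tendsto_point hτ hN hX₀ hhelm hX
  have hσ := (P.adjointSystem_iff hτ hN X₀ ms us ps).1 hadj
  rw [← hX.base] at hpt hσ hhess
  have htr := (P.forms τ hτ).hasFDerivAt_trace (s := fun w => (X w).point)
    (h := fun w => (X w).incr) hhess hpt (hfeas.mono fun w hw => hw.1)
    (hfeas.mono fun w hw => hw.2) hσ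
  rw [hasGradientAt_iff_hasFDerivAt]
  simp only [P.objective_eq]
  refine (htr.add (hasFDerivAt_penalty lam w₀)).congr_fderiv (ContinuousLinearMap.ext fun w' => ?_)
  refine Eq.trans ?_ (P.inner_gradVector lam w₀ w' ms us ps).symm
  have hpen : (∑ i, (2 * lam / (Nw : ℝ) * (‖w₀ i‖ ^ 2 - 1)) • (innerSL ℝ (w₀ i) ∘L
      (PiLp.proj 2 (fun _ : Fin Nw => EuclideanSpace ℝ (Fin Ns)) i :
        Weights Nw Ns →L[ℝ] EuclideanSpace ℝ (Fin Ns)))) w'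
      = ∑ i, 2 * lam / (Nw : ℝ) * (‖w₀ i‖ ^ 2 - 1) * inner ℝ (w₀ i) (w' i) := by
    simp only [sum_apply]
    rfl
  exact congrArg (fun r : ℝ => -load P.sourceL P.dataL w' (ms, ps, us) + r) hpen

end Conclusions

end Problem

end AOptHelmholtz

end

theorem mainTheorem1 {d q Ns Nw ntr : ℕ} (hNw : 0 < Nw) (hntr : 0 < ntr)
    {D : Set (Space d)} (hD : IsOpen D)
    (P : Problem D q Ns)
    -- parameter fields are essentially bounded
    (hbdd : ∀ m : P.prior.CM, MemLp (P.prior.toL2 m) ∞ (volume.restrict D))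
    (z : Fin ntr → L2 D) (lam : ℝ) (w₀ : Weights Nw Ns)
    (X₀ : Vars P Nw ntr) (hX₀ : P.Feasible z w₀ X₀)
    -- the Helmholtz problem at the MAP point is well-posed in `H¹(D)`
    (hHelm : ∀ F : H1 D →L[ℝ] ℝ, ∃! u : H1 D, ∀ u' : H1 D, P.helm X₀.m u u' = F u')
    -- the Hessian at the MAP point is invertible
    (hHess : ∀ F : P.prior.CM →L[ℝ] ℝ,
      ∃! s : P.prior.CM × (Fin Nw → H1 D) × (Fin Nw → H1 D),
        P.HessianSystem X₀.m X₀.u X₀.p F s.1 s.2.1 s.2.2) :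
    -- near `w₀` the constraints define one and only one branch through `X₀`
    (∃ X : Weights Nw Ns → Vars P Nw ntr, P.IsBranch z w₀ X₀ X ∧
      ∀ X' : Weights Nw Ns → Vars P Nw ntr, P.IsBranch z w₀ X₀ X' → X' =ᶠ[𝓝 w₀] X) ∧
    -- the system for `(m*, u*, p*)` is uniquely solvable
    (∃! s : P.prior.CM × (Fin Nw → H1 D) × (Fin Nw → H1 D),
      P.AdjointSystem X₀ s.1 s.2.1 s.2.2) ∧
    -- the multipliers making the Lagrangian stationary: symmetry relations and adjoint system
    (∀ Y : Vars P Nw ntr, P.Stationary z w₀ X₀ Y ↔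
      (∀ k, X₀.y k = -Y.y k) ∧ (∀ i k, X₀.v i k = -Y.q i k) ∧ (∀ i k, X₀.q i k = -Y.v i k) ∧
      P.AdjointSystem X₀ Y.m Y.u Y.p) ∧
    -- the gradient of the objective
    (∀ (ms : P.prior.CM) (us ps : Fin Nw → H1 D), P.AdjointSystem X₀ ms us ps →
      ∀ X : Weights Nw Ns → Vars P Nw ntr, P.IsBranch z w₀ X₀ X →
        HasGradientAt (fun w => P.objective z lam w (X w).y)
          (P.gradVector lam w₀ us ps) w₀) := by
  refine (P.exists_clm_tri hbdd).elim fun τ hτ => ?_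
  have hhelm := P.isInvertible_helm hτ X₀.m hHelm
  have hhess := P.isInvertible_hess_forms hτ hNw X₀ hHelm hHess
  exact ⟨P.exists_branch hτ hNw hX₀ hhelm hhess, P.existsUnique_adjointSystem hτ hNw X₀ hhess,
    fun Y => P.stationary_iff hτ z w₀ X₀ Y hNw hntr hX₀ hhess.injective,
    fun ms us ps hadj X hX => P.hasGradientAt_objective hτ hNw lam hX₀ hhelm hhess hadj hX⟩
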